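/- Let $X$ be a standard Borel space. A subrelation on a Borel set $D\subseteq X$ is a Borel equivalence relation on $D$ with countable classes. Let $S$ be an equivalence relation on a set $D$ and let $(S_j)_{j\in J}$ be a countable family of such subrelations, where $S_j$ is defined on the Borel set $D_j\subseteq D$ and is contained in $S$. We say that $S$ is the free product of the $S_j$, written $S=\star_{j}S_j$, if $S$ is the smallest equivalence relation on $D$ containing all the $S_j$ and if, whenever $n\ge 2$, $x_1,\dots,x_n\in D$ and $j_1,\dots,j_{n-1}\in J$ satisfy $x_n=x_1$, $(x_k,x_{k+1})\in S_{j_k}$ for $1\le k\le n-1$ and $j_k\ne j_{k+1}$ for $1\le k\le n-2$, there is $k\le n-1$ with $x_k=x_{k+1}$. A subrelation on $D$ is treeable if there is an acyclic Borel graph on $D$ whose connected components are its classes. For an equivalence relation $S$ on a subset of $X$ and $B\subseteq X$, write $S\cdot B$ for the set of points that are $S$-equivalent to a point of $B$, and $S|_B$ for the restriction of $S$ to $B$. For a Borel equivalence relation $\mathcal R$ on $X$, write $[[\mathcal R]]$ for the set of Borel isomorphisms $\varphi:B\to C$ between Borel subsets of $X$ with $(x,\varphi(x))\in\mathcal R$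 for all $x\in B$. For an equivalence relation $S$ on $C$, $\varphi^{-1}S\varphi$ is the relation on $B$ in which $x,y$ are equivalent if and only if $(\varphi(x),\varphi(y))\in S$. **Theorem.** Let $\mathcal R$ be a Borel equivalence relation with countable classes on $X$ that is the free product of a countable family of subrelations $\mathcal R_i$ ($i\in I$) defined on Borel sets $A_i\subseteq X$ with $\bigcup_{i\in I}A_i=X$. Let $A\subseteq X$ be any Borel set. Then there are countable sets $K(i)$ ($i\in I$), elements $\varphi_{k}:A_{k}\to\varphi_k(A_k)$ of $[[\mathcal R]]$ ($k\in K(i)$, $i\in I$) with $A_k$ a nonempty Borel subset of $A$ and $\varphi_k(A_k)\subseteq A_i$ for $k\in K(i)$, and a treeable subrelation $\mathcal T$ of $\mathcal R|_A$ defined on a Borel subset of $A$, such that $$\mathcal R|_A=\star_{i\in I}\bigl(\star_{k\in K(i)}\mathcal S_{k}\bigr)\star\mathcal T,\qquad \mathcal S_{k}=\varphi_{k}^{-1}\,\mathcal R_i|_{\varphi_{k}(A_{k})}\,\varphi_{k}\quad(k\in K(i)),$$ that is, $\mathcal R|_A$ is the free product of the family consisting of all the $\mathcal S_k$ and of $\mathcal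 T$. Moreover, for every $i\in I$, the $\mathcal R_i$-saturations $\mathcal R_i\cdot\varphi_k(A_k)$, $k\in K(i)$, are Borel and pairwise disjoint, and their union is $A_i\cap(\mathcal R\cdot A)$; in particular they form a countable Borel partition of $A_i$ when $A$ meets every $\mathcal R$-class. Finally, for every $i\in I$ with $A_i\cap A\neq\emptyset$ there is $k\in K(i)$ with $A_k=A_i\cap A$ and $\mathcal S_k=\mathcal R_i|_{A_i\cap A}$. -/

import Mathlib

namespace BER

/-- `r` is a Borel equivalence relation with countable classes on the Borel subset `D` of `X`.
It is encoded as a relation on `X` that holds only between points of `D`. -/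
structure IsCountableBorelEquivOn {X : Type*} [MeasurableSpace X]
    (D : Set X) (r : X → X → Prop) : Prop where
  measurableSet_domain : MeasurableSet D
  measurableSet_graph : MeasurableSet {p : X × X | r p.1 p.2}
  mem_domain : ∀ ⦃x y : X⦄, r x y → x ∈ D ∧ y ∈ D
  refl : ∀ ⦃x : X⦄, x ∈ D → r x x
  symm : ∀ ⦃x y : X⦄, r x y → r y x
  trans : ∀ ⦃x y z : X⦄, r x y → r y z → r x z
  countable_class : ∀ x : X, {y : X | r x y}.Countable

/-- The restriction of the relation `r` to the subset `B`. -/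
def restr {X : Type*} (r : X → X → Prop) (B : Set X) : X → X → Prop :=
  fun x y => x ∈ B ∧ y ∈ B ∧ r x y

/-- The `r`-saturation of `B`: the points that are `r`-equivalent to a point of `B`. -/
def saturation {X : Type*} (r : X → X → Prop) (B : Set X) : Set X :=
  {y : X | ∃ x ∈ B, r x y}

/-- Membership in the full pseudogroup `[[R]]`: `φ` is a Borel isomorphism from the Borel set
`φ.source` onto the Borel set `φ.target`, and its graph is contained in `R`. -/
structure MemFullPseudogroup {X : Type*} [MeasurableSpace X]
    (R : X → X → Prop) (φ : PartialEquiv X X) : Prop where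
  measurableSet_source : MeasurableSet φ.source
  measurableSet_target : MeasurableSet φ.target
  measurable_toFun : Measurable (φ.source.domRestrict φ)
  measurable_invFun : Measurable (φ.target.domRestrict φ.symm)
  graph_subset : ∀ x ∈ φ.source, R x (φ x)

/-- The conjugate `φ⁻¹ s φ`, a relation on the source of `φ`:
`x` and `y` are related when `φ x` and `φ y` are `s`-related. -/
def conj {X : Type*} (φ : PartialEquiv X X) (s : X → X → Prop) : X → X → Prop :=
  fun x y => x ∈ φ.source ∧ y ∈ φ.source ∧ s (φ x) (φ y)

/-- The relation `R` on `D` is the free product of the subrelations `r j`, where `r j` is a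
countable Borel equivalence relation on the Borel set `E j`. -/
structure IsFreeProduct {X ι : Type*} [MeasurableSpace X]
    (D : Set X) (R : X → X → Prop) (E : ι → Set X) (r : ι → X → X → Prop) : Prop where
  factor : ∀ j, IsCountableBorelEquivOn (E j) (r j)
  subrelation : ∀ j x y, r j x y → R x y
  /-- `R` is the smallest equivalence relation on `D` that contains all the `r j`. -/
  generates : ∀ x y, R x y ↔
    x ∈ D ∧ y ∈ D ∧ Relation.EqvGen (fun a b => ∃ j, r j a b) x y
  /-- In a closed chain `x 0, …, x n = x 0` whose successive steps lie in factors with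
  successively distinct indices, some step is trivial. -/
  reduced : ∀ (n : ℕ) (x : ℕ → X) (j : ℕ → ι), 0 < n →
    (∀ k < n, r (j k) (x k) (x (k + 1))) →
    (∀ k, k + 1 < n → j k ≠ j (k + 1)) →
    x n = x 0 → ∃ k < n, x k = x (k + 1)

/-- The relation `r` is a treeable countable Borel equivalence relation on the Borel set `D`:
some acyclic Borel graph has the `r`-classes as its connected components on `D`
and has no edge outside `D`. -/
structure IsTreeable {X : Type*} [MeasurableSpace X]
    (D : Set X) (r : X → X → Prop) : Prop where
  isCountableBorelEquivOn : IsCountableBorelEquivOn D r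
  exists_treeing : ∃ G : SimpleGraph X,
    MeasurableSet {p : X × X | G.Adj p.1 p.2} ∧ G.IsAcyclic ∧
    (∀ x y, G.Adj x y → x ∈ D ∧ y ∈ D) ∧
    ∀ x y, r x y ↔ x ∈ D ∧ y ∈ D ∧ G.Reachable x y

end BER

/-!
By the Lusin–Novikov theorem, countably many Borel maps enumerate the classes of `R`. With their
help each point of the saturation of `A` is moved to `A` by steps inside the factors, each of which
decreases the distance to `A`; this is the projection. Each class of a factor is moreover retracted
in a Borel way onto a subset on which the projection is injective. Transporting the factor from
such a subset to `A` along the projection gives the relations `𝒮_k`, and joining the projection of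
each point to that of its retraction gives the graph of `𝒯`.

Freeness is tested with cocycles. Arbitrary potentials with values in a group, one on each factor of
a free product, extend to a cocycle. Conversely, relations on which arbitrary potentials extend to a
cocycle are in free position: use the generators of a free product of free groups as potentials.
Potentials on the `𝒮_k` and on `𝒯` extend because they can be lifted to the factors of `R`, in such
a way that the resulting cocycle is trivial along the steps of the projection. Similarly, a cocycle
that is nontrivial on a single edge only shows that this edge is a bridge of the graph of `𝒯`.
-/

namespace BER

open Set

/-! ### The Lusin–Novikov theorem -/

section LusinNovikov

open Filter Topology MeasureTheory TopologicalSpace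

variable {Z Y : Type*} [MeasurableSpace Z] {π : Z → Y}

/-- `M` is a countable union of Borel sets on each of which `π` is injective. -/
def IsSigmaInjOn (π : Z → Y) (M : Set Z) : Prop :=
  ∃ Q : Set (Set Z), Q.Countable ∧ (∀ q ∈ Q, MeasurableSet q ∧ InjOn π q) ∧ ⋃₀ Q = M

theorem IsSigmaInjOn.measurableSet {M : Set Z} (h : IsSigmaInjOn π M) : MeasurableSet M := by
  obtain ⟨Q, hQ, hq, rfl⟩ := h
  exact .sUnion hQ fun q h => (hq q h).1

theorem isSigmaInjOn_empty : IsSigmaInjOn π ∅ :=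
  ⟨∅, countable_empty, by simp, sUnion_empty⟩

theorem IsSigmaInjOn.iUnion {ι : Type*} [Countable ι] {M : ι → Set Z}
    (h : ∀ i, IsSigmaInjOn π (M i)) : IsSigmaInjOn π (⋃ i, M i) := by
  choose Q hQ hq hM using h
  refine ⟨⋃ i, Q i, countable_iUnion hQ, fun q hqQ => ?_, ?_⟩
  · obtain ⟨i, hi⟩ := mem_iUnion.1 hqQ
    exact hq i q hi
  · rw [sUnion_iUnion]
    exact iUnion_congr hM

theorem IsSigmaInjOn.union_injOn {M N : Set Z} (hM : IsSigmaInjOn π M) (hN : MeasurableSet N)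
    (hinj : InjOn π N) : IsSigmaInjOn π (M ∪ N) := by
  obtain ⟨Q, hQ, hq, rfl⟩ := hM
  exact ⟨insert N Q, hQ.insert N, forall_mem_insert.2 ⟨⟨hN, hinj⟩, hq⟩,
    (sUnion_insert _ _).trans (union_comm _ _)⟩

theorem analyticSet_inter {α : Type*} [TopologicalSpace α] [T2Space α] {s t : Set α}
    (hs : AnalyticSet s) (ht : AnalyticSet t) : AnalyticSet (s ∩ t) := by
  rw [inter_eq_iInter]
  exact .iInter (Bool.forall_bool.2 ⟨ht, hs⟩)

theorem exists_isClosed_ediam_le_separating (α : Type*) [MetricSpace α]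
    [SecondCountableTopology α] {ε : ENNReal} (hε : 0 < ε) :
    ∃ 𝒱 : Set (Set α), 𝒱.Countable ∧ (∀ V ∈ 𝒱, IsClosed V ∧ Metric.ediam V ≤ ε) ∧
      ∀ x y, x ≠ y → ∃ V ∈ 𝒱, ∃ W ∈ 𝒱, x ∈ V ∧ y ∈ W ∧ Disjoint V W := by
  have hsmall : ∀ x : α, ∀ u ∈ 𝓝 x, ∃ b ∈ countableBasis α,
      x ∈ closure b ∧ closure b ⊆ u ∧ Metric.ediam (closure b) ≤ ε := by
    intro x u hu
    obtain ⟨b, hb, hxb, hbu⟩ := (isBasis_countableBasis α).exists_closure_subset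
      (inter_mem hu (Metric.eball_mem_nhds x (ENNReal.half_pos hε.ne')))
    refine ⟨b, hb, subset_closure hxb, hbu.trans inter_subset_left, ?_⟩
    calc Metric.ediam (closure b) ≤ Metric.ediam (Metric.eball x (ε / 2)) :=
          Metric.ediam_mono (hbu.trans inter_subset_right)
      _ ≤ 2 * (ε / 2) := Metric.ediam_eball_le
      _ = ε := ENNReal.mul_div_cancel (by simp) (by simp)
  refine ⟨{V ∈ closure '' countableBasis α | Metric.ediam V ≤ ε},
    ((countable_countableBasis α).image _).mono (sep_subset _ _), ?_, fun x y hxy => ?_⟩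
  · rintro _ ⟨⟨b, -, rfl⟩, hb⟩
    exact ⟨isClosed_closure, hb⟩
  · obtain ⟨u, v, hu, hv, huv⟩ := t2_separation_nhds hxy
    obtain ⟨b, hb, hxb, hbu, hbε⟩ := hsmall x u hu
    obtain ⟨c, hc, hyc, hcv, hcε⟩ := hsmall y v hv
    exact ⟨_, ⟨⟨b, hb, rfl⟩, hbε⟩, _, ⟨⟨c, hc, rfl⟩, hcε⟩, hxb, hyc, huv.mono hbu hcv⟩

/-- Off every countable union of Borel sets on which `π` is injective, some fibre of `π` meets all
the members of `F`. -/
def IsLarge (π : Z → Y) (F : Set (Set Z)) : Prop :=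
  ∀ M, IsSigmaInjOn π M → ∃ y, ∀ U ∈ F, ∃ z ∈ U, π z = y ∧ z ∉ M

theorem IsLarge.mono {F F' : Set (Set Z)} (h : IsLarge π F) (hF : F' ⊆ F) : IsLarge π F' :=
  fun M hM => (h M hM).imp fun _ hy U hU => hy U (hF hU)

section Continuous

variable [TopologicalSpace Z] [PolishSpace Z] [BorelSpace Z]
  [TopologicalSpace Y] [T2Space Y] [MeasurableSpace Y] [BorelSpace Y]

theorem exists_measurableSet_injOn_superset (hπ : Continuous π) {E : Set Z}
    (hE : AnalyticSet E) (hinj : InjOn π E) : ∃ Q, E ⊆ Q ∧ MeasurableSet Q ∧ InjOn π Q := by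
  let bit : Z → ℕ → Bool := MeasurableSpace.mapNatBool Z
  have hbit : ∀ n b, MeasurableSet {z | bit z n = b} := fun n b =>
    measurableSet_eq_fun ((measurable_pi_apply n).comp (MeasurableSpace.measurable_mapNatBool Z))
      measurable_const
  have hsep : ∀ n, MeasurablySeparable (π '' (E ∩ {z | bit z n = true}))
      (π '' (E ∩ {z | bit z n = false})) := fun n => by
    refine AnalyticSet.measurablySeparable
      ((analyticSet_inter hE (hbit n true).analyticSet).image_of_continuous hπ)
      ((analyticSet_inter hE (hbit n false).analyticSet).image_of_continuous hπ) ?_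
    rw [Set.disjoint_left]
    rintro _ ⟨z, ⟨hz, hzt⟩, rfl⟩ ⟨w, ⟨hw, hwf⟩, hwz⟩
    obtain rfl := hinj hw hz hwz
    exact Bool.false_ne_true (hwf.symm.trans hzt)
  choose u htrue hfalse hu using hsep
  refine ⟨⋂ n, {z | π z ∈ u n ↔ bit z n = true}, fun z hz => ?_,
    .iInter fun n => (hπ.measurable (hu n)).iff (hbit n true), fun z hz w hw hzw => ?_⟩
  · refine mem_iInter.2 fun n => ⟨fun hzu => ?_, fun hzn => htrue n ⟨z, ⟨hz, hzn⟩, rfl⟩⟩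
    by_contra hzn
    exact Set.disjoint_left.1 (hfalse n) ⟨z, ⟨hz, by simpa using hzn⟩, rfl⟩ hzu
  · refine MeasurableSpace.injective_mapNatBool Z (funext fun n => Bool.eq_iff_iff.2 ?_)
    have hw' : π z ∈ u n ↔ bit w n = true := hzw ▸ mem_iInter.1 hw n
    exact (mem_iInter.1 hz n).symm.trans hw'

/-- `W true` and `W false` are disjoint closed subsets of `U` of diameter at most `ε`. -/
structure IsSplitting {α : Type*} [PseudoEMetricSpace α] (ε : ENNReal) (U : Set α)
    (W : Bool → Set α) : Prop where
  subset : ∀ b, W b ⊆ U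
  isClosed : ∀ b, IsClosed (W b)
  ediam_le : ∀ b, Metric.ediam (W b) ≤ ε
  disjoint : Pairwise (Function.onFun Disjoint W)

/-- Otherwise each pair of disjoint `V` and `W` has an exceptional set outside of which no fibre
meets all of `U ∩ V`, `U ∩ W` and the members of `F`. Off the union of these exceptional sets, `π`
is injective on the points of `U` in fibres meeting all members of `F`; they form an analytic set,
so they can be absorbed in one more exceptional set. -/
theorem IsLarge.exists_disjoint_inter (hπ : Continuous π) {F : Set (Set Z)} {U : Set Z}
    (hF : F.Countable) (hFm : ∀ W ∈ F, MeasurableSet W) (hU : MeasurableSet U)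
    (h : IsLarge π (insert U F)) {𝒱 : Set (Set Z)} (h𝒱 : 𝒱.Countable)
    (hsep : ∀ x y, x ≠ y → ∃ V ∈ 𝒱, ∃ W ∈ 𝒱, x ∈ V ∧ y ∈ W ∧ Disjoint V W) :
    ∃ V ∈ 𝒱, ∃ W ∈ 𝒱, Disjoint V W ∧ IsLarge π (insert (U ∩ V) (insert (U ∩ W) F)) := by
  by_contra! hcon
  simp only [IsLarge, not_forall] at hcon
  choose! M hM hno using hcon
  let P := {p : 𝒱 × 𝒱 // Disjoint (p.1 : Set Z) p.2}
  have : Countable 𝒱 := h𝒱.to_subtype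
  let N := ⋃ p : P, M p.1.1 p.1.2
  have hN : IsSigmaInjOn π N :=
    .iUnion fun p => hM _ p.1.1.2 _ p.1.2.2 p.2
  have hMN : ∀ V ∈ 𝒱, ∀ W ∈ 𝒱, Disjoint V W → M V W ⊆ N :=
    fun V hV W hW hVW => subset_iUnion (fun p : P => M p.1.1 p.1.2) ⟨⟨⟨V, hV⟩, ⟨W, hW⟩⟩, hVW⟩
  have hdiff : ∀ W, MeasurableSet W → AnalyticSet (W \ N) := fun W hW =>
    (hW.diff hN.measurableSet).analyticSet
  let E := U \ N ∩ ⋂ W : ↥(insert U F), π ⁻¹' (π '' (W \ N))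
  have hE : AnalyticSet E := by
    have : Countable ↥(insert U F) := (hF.insert U).to_subtype
    have : Nonempty ↥(insert U F) := ⟨⟨U, mem_insert _ _⟩⟩
    exact analyticSet_inter (hdiff U hU) (.iInter fun W => .preimage
      ((hdiff W (forall_mem_insert.2 ⟨hU, hFm⟩ W W.2)).image_of_continuous hπ) hπ)
  have hinj : InjOn π E := by
    rintro z ⟨⟨hzU, hzN⟩, hz⟩ w ⟨⟨hwU, hwN⟩, -⟩ hzw
    by_contra hne
    obtain ⟨V, hV, W, hW, hzV, hwW, hVW⟩ := hsep z w hne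
    have hout : ∀ x, x ∉ N → x ∉ M V W := fun x hx hxM => hx (hMN V hV W hW hVW hxM)
    refine hno V hV W hW hVW ⟨π z, forall_mem_insert.2 ⟨⟨z, ⟨hzU, hzV⟩, rfl, hout z hzN⟩,
      forall_mem_insert.2 ⟨⟨w, ⟨hwU, hwW⟩, hzw.symm, hout w hwN⟩, fun T hT => ?_⟩⟩⟩
    obtain ⟨t, ⟨htT, htN⟩, htz⟩ := mem_iInter.1 hz ⟨T, mem_insert_of_mem _ hT⟩
    exact ⟨t, htT, htz, hout t htN⟩
  obtain ⟨Q, hEQ, hQm, hQinj⟩ := exists_measurableSet_injOn_superset hπ hE hinj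
  obtain ⟨y, hy⟩ := h (N ∪ Q) (hN.union_injOn hQm hQinj)
  obtain ⟨z, hzU, rfl, hzNQ⟩ := hy U (mem_insert _ _)
  refine hzNQ (.inr (hEQ ⟨⟨hzU, fun h => hzNQ (.inl h)⟩, mem_iInter.2 fun W => ?_⟩))
  obtain ⟨w, hwW, hwz, hwNQ⟩ := hy W W.2
  exact ⟨w, ⟨hwW, fun h => hwNQ (.inl h)⟩, hwz⟩

end Continuous

section Metric

variable [MetricSpace Z] [SecondCountableTopology Z] [CompleteSpace Z] [BorelSpace Z]
  [TopologicalSpace Y] [T2Space Y] [MeasurableSpace Y] [BorelSpace Y]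

theorem IsLarge.exists_isSplitting (hπ : Continuous π) {F : Set (Set Z)} {U : Set Z}
    (hF : F.Countable) (hFc : ∀ W ∈ F, IsClosed W) (hU : IsClosed U)
    (h : IsLarge π (insert U F)) {ε : ENNReal} (hε : 0 < ε) :
    ∃ W, IsSplitting ε U W ∧ IsLarge π (F ∪ range W) := by
  obtain ⟨𝒱, h𝒱, hsmall, hsep⟩ := exists_isClosed_ediam_le_separating Z hε
  obtain ⟨V, hV, W, hW, hVW, hlarge⟩ := h.exists_disjoint_inter hπ hF
    (fun W hW => (hFc W hW).measurableSet) hU.measurableSet h𝒱 hsep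
  let C : Bool → Set Z := fun b => if b then V else W
  have hC : ∀ b, C b ∈ 𝒱 := by simp [C, hV, hW]
  refine ⟨fun b => U ∩ C b, ⟨fun b => inter_subset_left, fun b => hU.inter (hsmall _ (hC b)).1,
    fun b => (Metric.ediam_mono inter_subset_right).trans (hsmall _ (hC b)).2,
    fun b c hbc => ?_⟩, hlarge.mono (union_subset ?_ ?_)⟩
  · refine Disjoint.mono inter_subset_right inter_subset_right ?_
    cases b <;> cases c <;> simp_all [C, hVW.symm]
  · exact (subset_insert _ _).trans (subset_insert _ _)
  · rintro _ ⟨_ | _, rfl⟩ <;> simp [C]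

theorem IsLarge.exists_isSplitting_of_finite (hπ : Continuous π) {T : Set (Set Z)} (hT : T.Finite)
    (hTc : ∀ U ∈ T, IsClosed U) {ε : ENNReal} (hε : 0 < ε) {F : Set (Set Z)} (hF : F.Countable)
    (hFc : ∀ W ∈ F, IsClosed W) (h : IsLarge π (F ∪ T)) :
    ∃ W : Set Z → Bool → Set Z, (∀ U ∈ T, IsSplitting ε U (W U)) ∧
      IsLarge π (F ∪ ⋃ U ∈ T, range (W U)) := by
  classical
  induction T, hT using Set.Finite.induction_on generalizing F with
  | empty => exact ⟨fun _ _ => ∅, by simp, h.mono (by simp)⟩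
  | @insert U T hUT hT ih =>
    obtain ⟨hU, hTc⟩ := forall_mem_insert.1 hTc
    obtain ⟨V, hV, hlarge⟩ := IsLarge.exists_isSplitting hπ (hF.union hT.countable)
      (fun W hW => hW.elim (hFc W) (hTc W)) hU (h.mono union_insert.superset) hε
    obtain ⟨W, hW, hlarge⟩ := ih (F := F ∪ range V) hTc (hF.union (countable_range V))
      (fun W hW => hW.elim (hFc W) (by rintro ⟨b, rfl⟩; exact hV.isClosed b))
      (hlarge.mono (union_right_comm _ _ _).subset)
    have hne : ∀ S ∈ T, S ≠ U := fun S hS hSU => hUT (hSU ▸ hS)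
    have hTW : ⋃ S ∈ T, range (Function.update W U V S) = ⋃ S ∈ T, range (W S) :=
      iUnion₂_congr fun S hS => by rw [Function.update_of_ne (hne S hS)]
    refine ⟨Function.update W U V, forall_mem_insert.2 ⟨by simpa using hV, fun S hS => ?_⟩, ?_⟩
    · simpa [hne S hS] using hW S hS
    · rwa [biUnion_insert, Function.update_self, hTW, ← union_assoc]

theorem IsLarge.exists_scheme (hπ : Continuous π) (h : IsLarge π {univ}) :
    ∃ D : List Bool → Set Z, (∀ s, IsClosed (D s)) ∧
      (∀ s, IsSplitting ((s.length + 1 : ℕ) : ENNReal)⁻¹ (D s) fun b => D (b :: s)) ∧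
      ∀ n, IsLarge π (D '' {s | s.length = n}) := by
  let Level := {T : Set (Set Z) // T.Finite ∧ (∀ U ∈ T, IsClosed U) ∧ IsLarge π T}
  have hstep : ∀ (n : ℕ) (T : Level), ∃ W : Set Z → Bool → Set Z,
      (∀ U ∈ T.1, IsSplitting ((n + 1 : ℕ) : ENNReal)⁻¹ U (W U)) ∧
      IsLarge π (⋃ U ∈ T.1, range (W U)) := fun n T => by
    simpa using IsLarge.exists_isSplitting_of_finite hπ T.2.1 T.2.2.1
      (ENNReal.inv_pos.2 (ENNReal.natCast_ne_top (n + 1))) countable_empty (by simp)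
      (by simpa using T.2.2.2)
  choose W hsplit hlarge using hstep
  let next (n : ℕ) (T : Level) : Level := ⟨⋃ U ∈ T.1, range (W n T U),
    T.2.1.biUnion fun U _ => finite_range _, by
      simp only [mem_iUnion, mem_range, forall_exists_index]
      rintro _ U hU b rfl
      exact (hsplit n T U hU).isClosed b, hlarge n T⟩
  let level (n : ℕ) : Level := n.rec ⟨{univ}, finite_singleton _, by simp, h⟩ next
  let D (s : List Bool) : Set Z := s.rec univ fun b t U => W t.length (level t.length) U b
  have hD : ∀ s, D s ∈ (level s.length).1 := fun s => by
    induction s with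
    | nil => exact mem_singleton _
    | cons b s ih => exact mem_biUnion ih (mem_range_self b)
  refine ⟨D, fun s => (level _).2.2.1 _ (hD s), fun s => hsplit _ _ _ (hD s), fun n => ?_⟩
  refine (level n).2.2.2.mono ?_
  rintro _ ⟨s, rfl, rfl⟩
  exact hD s

theorem IsLarge.exists_not_countable_fiber (hπ : Continuous π) (h : IsLarge π {univ}) :
    ∃ y, ¬ (π ⁻¹' {y}).Countable := by
  obtain ⟨D, hclosed, hsplit, hlarge⟩ := h.exists_scheme hπ
  have hpoint : ∀ n, ∃ y, ∀ s : List Bool, s.length = n → ∃ z ∈ D s, π z = y := fun n =>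
    (hlarge n ∅ isSigmaInjOn_empty).imp fun y hy s hs =>
      let ⟨z, hz, hzy, _⟩ := hy (D s) ⟨s, hs, rfl⟩
      ⟨z, hz, hzy⟩
  choose y hy using hpoint
  have hantitone : CantorScheme.ClosureAntitone D :=
    CantorScheme.Antitone.closureAntitone (fun s b => (hsplit s).subset b) hclosed
  have hdiam : CantorScheme.VanishingDiam D := fun c => by
    refine tendsto_of_tendsto_of_tendsto_of_le_of_le tendsto_const_nhds
      ENNReal.tendsto_inv_nat_nhds_zero (fun _ => zero_le) fun n => ?_
    cases n with
    | zero => simp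
    | succ n => simpa using (hsplit (PiNat.res c n)).ediam_le (c n)
  have hdom := hantitone.map_of_vanishingDiam hdiam fun s => (hy _ s rfl).imp fun _ hz => hz.1
  let φ : (ℕ → Bool) → Z := fun c => (CantorScheme.inducedMap D).2 ⟨c, hdom ▸ mem_univ c⟩
  have hφ : Function.Injective φ := fun c c' hcc' =>
    congrArg Subtype.val (CantorScheme.Disjoint.map_injective (fun s => (hsplit s).disjoint) hcc')
  have hlim : ∀ c, Tendsto y atTop (𝓝 (π (φ c))) := fun c => by
    choose z hz hzy using fun n => hy n (PiNat.res c n) (PiNat.res_length c n)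
    have hzφ : Tendsto z atTop (𝓝 (φ c)) := by
      refine tendsto_iff_edist_tendsto_0.2 (tendsto_of_tendsto_of_tendsto_of_le_of_le
        tendsto_const_nhds (hdiam c) (fun _ => zero_le) fun n => ?_)
      exact Metric.edist_le_ediam_of_mem (hz n) (CantorScheme.map_mem _ n)
    exact ((hπ.tendsto _).comp hzφ).congr hzy
  refine ⟨π (φ fun _ => true), fun hcount => ?_⟩
  have huniv : (univ : Set (ℕ → Bool)).Countable :=
    MapsTo.countable_of_injOn (f := φ) (t := π ⁻¹' {π (φ fun _ => true)})
      (fun c _ => tendsto_nhds_unique (hlim c) (hlim _)) hφ.injOn hcount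
  rw [← Cardinal.le_aleph0_iff_set_countable] at huniv
  simp [Cardinal.aleph0_lt_continuum.not_ge] at huniv

end Metric

/-- The **Lusin–Novikov theorem**. -/
theorem isSigmaInjOn_univ_of_countable_fiber [StandardBorelSpace Z] [TopologicalSpace Y]
    [T2Space Y] [SecondCountableTopology Y] [MeasurableSpace Y] [BorelSpace Y]
    (hπ : Measurable π) (hcount : ∀ y, (π ⁻¹' {y}).Countable) : IsSigmaInjOn π univ := by
  let polish := upgradeStandardBorel Z
  obtain ⟨t, hle, hcont, ht⟩ := hπ.exists_continuous
  have hborel : @BorelSpace Z t _ :=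
    @BorelSpace.mk Z t _ (polish.toBorelSpace.measurable_eq.trans
      (borel_eq_borel_of_le ht polish.toPolishSpace hle).symm)
  clear hle polish
  let := upgradeIsCompletelyMetrizable Z
  by_contra hcon
  obtain ⟨y, hy⟩ := IsLarge.exists_not_countable_fiber hcont fun M hM => by
    obtain ⟨z, -, hz⟩ := Set.not_subset.1 fun h => hcon (univ_subset_iff.1 h ▸ hM)
    exact ⟨π z, by simpa using ⟨z, rfl, hz⟩⟩
  exact hy (hcount y)

theorem IsCountableBorelEquivOn.exists_enumeration {X : Type*} [MeasurableSpace X]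
    [StandardBorelSpace X] {R : X → X → Prop} (hR : IsCountableBorelEquivOn univ R) :
    ∃ f : ℕ → X → X, (∀ n, Measurable (f n)) ∧ ∀ x y, R x y ↔ ∃ n, f n x = y := by
  let := upgradeStandardBorel X
  have := hR.measurableSet_graph.standardBorel
  let π : ↥{p : X × X | R p.1 p.2} → X := fun p => p.1.1
  have hπ : Measurable π := measurable_fst.comp measurable_subtype_coe
  obtain ⟨Q, hQ, hq, hcover⟩ := isSigmaInjOn_univ_of_countable_fiber hπ fun x => by
    refine MapsTo.countable_of_injOn (f := fun p => p.1.2) ?_ ?_ (hR.countable_class x)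
    · rintro ⟨p, hp⟩ rfl
      exact hp
    · rintro p rfl q hpq h
      exact Subtype.ext (Prod.ext hpq.symm h)
  obtain ⟨q, hQq⟩ := (hQ.insert ∅).exists_eq_range (insert_nonempty _ _)
  have hq' : ∀ n, MeasurableSet (q n) ∧ InjOn π (q n) := fun n =>
    forall_mem_insert.2 ⟨⟨.empty, injOn_empty _⟩, hq⟩ _ (hQq ▸ mem_range_self n)
  have hemb : ∀ n, MeasurableEmbedding ((q n).domRestrict π) := fun n =>
    have := (hq' n).1.standardBorel
    (hπ.comp measurable_subtype_coe).measurableEmbedding (hq' n).2.injective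
  let f : ℕ → X → X := fun n => Function.extend ((q n).domRestrict π) (fun p => p.1.1.2) id
  have hf : ∀ n (p : q n), f n (π p) = p.1.1.2 := fun n p => (hemb n).injective.extend_apply _ _ p
  refine ⟨f, fun n => (hemb n).measurable_extend (measurable_snd.comp
    (measurable_subtype_coe.comp measurable_subtype_coe)) measurable_id,
    fun x y => ⟨fun h => ?_, ?_⟩⟩
  · obtain ⟨s, hs, hxys⟩ : (⟨(x, y), h⟩ : ↥{p : X × X | R p.1 p.2}) ∈ ⋃₀ Q := hcover ▸ mem_univ _
    obtain ⟨n, rfl⟩ : s ∈ range q := hQq ▸ mem_insert_of_mem _ hs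
    exact ⟨n, hf n ⟨_, hxys⟩⟩
  · rintro ⟨n, rfl⟩
    by_cases hx : ∃ p : q n, π p = x
    · obtain ⟨p, rfl⟩ := hx
      exact (hf n p).symm ▸ p.1.2
    · have hfx : f n x = x := Function.extend_apply' _ _ _ hx
      exact hfx.symm ▸ hR.refl (mem_univ x)

end LusinNovikov

/-! ### Cocycles and free products -/

section Cocycles

variable {X ι G : Type*} [Group G]

/-- The increment from `x` to `y` of the potential `g`. -/
def coboundary (g : X → G) (x y : X) : G := g x * (g y)⁻¹

@[simp]
theorem coboundary_self (g : X → G) (x : X) : coboundary g x x = 1 := mul_inv_cancel _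

@[simp]
theorem coboundary_mul_coboundary (g : X → G) (x y z : X) :
    coboundary g x y * coboundary g y z = coboundary g x z := by
  simp [coboundary, mul_assoc]

@[simp]
theorem coboundary_inv (g : X → G) (x y : X) : (coboundary g x y)⁻¹ = coboundary g y x := by
  simp [coboundary]

/-- `c` is a cocycle on the relation `R`: it is multiplicative along consecutive pairs. -/
def IsCocycle (R : X → X → Prop) (c : X → X → G) : Prop :=
  ∀ ⦃x y z⦄, R x y → R y z → c x z = c x y * c y z

namespace IsCocycle

variable {R : X → X → Prop} {c : X → X → G}

theorem map_self (hc : IsCocycle R c) {x : X} (hx : R x x) : c x x = 1 :=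
  left_eq_mul.1 (hc hx hx)

theorem map_swap (hc : IsCocycle R c) (hR : Equivalence R) {x y : X} (hxy : R x y) :
    c y x = (c x y)⁻¹ := by
  rw [eq_inv_iff_mul_eq_one, ← hc (hR.symm hxy) hxy, hc.map_self (hR.refl y)]

end IsCocycle

/-- The ordered product of the increments of the potentials `g` along the first `n` steps of the
chain `x`, the `k`-th step being measured by the potential `g (j k)`. -/
def chainProd (g : ι → X → G) : ℕ → (ℕ → X) → (ℕ → ι) → G
  | 0, _, _ => 1
  | n + 1, x, j => coboundary (g (j 0)) (x 0) (x 1) *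
      chainProd g n (fun k => x (k + 1)) (fun k => j (k + 1))

theorem IsCocycle.chainProd_eq {R : X → X → Prop} {c : X → X → G} {r : ι → X → X → Prop}
    {g : ι → X → G} (hc : IsCocycle R c) (hR : Equivalence R) (hr : ∀ i x y, r i x y → R x y)
    (hcr : ∀ i x y, r i x y → c x y = coboundary (g i) x y) {n : ℕ} {x : ℕ → X} {j : ℕ → ι}
    (hx : ∀ k < n, r (j k) (x k) (x (k + 1))) :
    R (x 0) (x n) ∧ chainProd g n x j = c (x 0) (x n) := by
  induction n generalizing x j with
  | zero => exact ⟨hR.refl _, (hc.map_self (hR.refl _)).symm⟩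
  | succ n ih =>
    obtain ⟨htail, heq⟩ := ih (x := fun k => x (k + 1)) (j := fun k => j (k + 1))
      fun k hk => hx (k + 1) (Nat.succ_lt_succ hk)
    have hhead := hr _ _ _ (hx 0 n.succ_pos)
    exact ⟨hR.trans hhead htail,
      by rw [chainProd, heq, ← hcr _ _ _ (hx 0 n.succ_pos), hc hhead htail]⟩

/-- The chain `x` of length `n` consists of nontrivial steps in the relations `r (j k)`, and
successive steps lie in different relations. -/
structure IsReducedChain (r : ι → X → X → Prop) (n : ℕ) (x : ℕ → X) (j : ℕ → ι) : Prop where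
  step : ∀ k < n, r (j k) (x k) (x (k + 1))
  ne : ∀ k < n, x k ≠ x (k + 1)
  index : ∀ k, k + 1 < n → j k ≠ j (k + 1)

namespace IsReducedChain

variable {r : ι → X → X → Prop} {n : ℕ} {x : ℕ → X} {j : ℕ → ι}

theorem tail (h : IsReducedChain r (n + 1) x j) :
    IsReducedChain r n (fun k => x (k + 1)) (fun k => j (k + 1)) :=
  ⟨fun k hk => h.step (k + 1) (by omega), fun k hk => h.ne (k + 1) (by omega),
    fun k hk => h.index (k + 1) (by omega)⟩

theorem cons (h : IsReducedChain r n x j) {a : X} {i : ι} (hr : r i a (x 0)) (hne : a ≠ x 0)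
    (hi : 0 < n → i ≠ j 0) :
    IsReducedChain r (n + 1) (fun k => Nat.casesOn k a x) (fun k => Nat.casesOn k i j) where
  step := by
    rintro (_ | k) hk
    exacts [hr, h.step k (by omega)]
  ne := by
    rintro (_ | k) hk
    exacts [hne, h.ne k (by omega)]
  index := by
    rintro (_ | k) hk
    exacts [hi (by omega), h.index k (by omega)]

end IsReducedChain

/-- The point `x`, regarded as a generator of the `i`-th of `ι` copies of the free group on `X`:
the universal family of potentials. -/
def freePotential (i : ι) (x : X) : Monoid.CoprodI fun _ : ι => FreeGroup X :=
  Monoid.CoprodI.of (i := i) (FreeGroup.of x)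

theorem IsReducedChain.exists_neWord_prod_eq {r : ι → X → X → Prop} {n : ℕ} {x : ℕ → X}
    {j : ℕ → ι} (h : IsReducedChain r (n + 1) x j) :
    ∃ w : Monoid.CoprodI.NeWord (fun _ : ι => FreeGroup X) (j 0) (j n),
      w.prod = chainProd freePotential (n + 1) x j := by
  let a : FreeGroup X := FreeGroup.of (x 0) * (FreeGroup.of (x 1))⁻¹
  have ha : a ≠ 1 := fun h1 => h.ne 0 n.succ_pos (FreeGroup.of_injective (mul_inv_eq_one.1 h1))
  have hprod : Monoid.CoprodI.of (M := fun _ : ι => FreeGroup X) (i := j 0) a =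
      coboundary (freePotential (j 0)) (x 0) (x 1) := by
    simp [a, coboundary, freePotential]
  induction n generalizing x j with
  | zero => exact ⟨.singleton a ha, by simp [chainProd, hprod]⟩
  | succ n ih =>
    obtain ⟨w, hw⟩ := ih h.tail
      (fun h1 => h.ne 1 (by omega) (FreeGroup.of_injective (mul_inv_eq_one.1 h1)))
      (by simp [coboundary, freePotential])
    exact ⟨.append (.singleton a ha) (h.index 0 (by omega)) w, by
      rw [Monoid.CoprodI.NeWord.append_prod, hw, Monoid.CoprodI.NeWord.prod_singleton, hprod]; rfl⟩

theorem neWord_prod_ne_one {M : ι → Type*} [∀ i, Monoid (M i)] {i j : ι}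
    (w : Monoid.CoprodI.NeWord M i j) : w.prod ≠ 1 := by
  classical
  intro h
  have hw : w.toWord = .empty := Monoid.CoprodI.Word.equiv.symm.injective h
  exact w.toList_ne_nil (congrArg Monoid.CoprodI.Word.toList hw)

theorem IsReducedChain.ne_of_isCocycle {R : X → X → Prop} {r : ι → X → X → Prop}
    {c : X → X → Monoid.CoprodI fun _ : ι => FreeGroup X} (hc : IsCocycle R c)
    (hR : Equivalence R) (hr : ∀ i x y, r i x y → R x y)
    (hcr : ∀ i x y, r i x y → c x y = coboundary (freePotential i) x y) {n : ℕ} {x : ℕ → X}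
    {j : ℕ → ι} (h : IsReducedChain r n x j) (hn : 0 < n) : x n ≠ x 0 := by
  obtain ⟨n, rfl⟩ := Nat.exists_eq_succ_of_ne_zero hn.ne'
  obtain ⟨w, hw⟩ := h.exists_neWord_prod_eq
  intro hclosed
  refine neWord_prod_ne_one w ?_
  rw [hw, (hc.chainProd_eq hR hr hcr h.step).2, hclosed, hc.map_self (hR.refl _)]

/-- `γ` is the product of the increments of the potentials `g` along some reduced chain
from `a` to `b`. -/
def HasHolonomy (r : ι → X → X → Prop) (g : ι → X → G) (a b : X) (γ : G) : Prop :=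
  ∃ n x j, IsReducedChain r n x j ∧ x 0 = a ∧ x n = b ∧ chainProd g n x j = γ

namespace HasHolonomy

variable {r : ι → X → X → Prop} {g : ι → X → G} {a b d : X} {γ δ : G}

theorem refl [Nonempty ι] (r : ι → X → X → Prop) (g : ι → X → G) (a : X) :
    HasHolonomy r g a a 1 :=
  ⟨0, fun _ => a, fun _ => Classical.arbitrary ι, ⟨by simp, by simp, by simp⟩, rfl, rfl, rfl⟩

variable (htrans : ∀ i ⦃x y z⦄, r i x y → r i y z → r i x z)
include htrans

/-- A step in the same factor as the first step of the chain is merged with it, and the merged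
step is dropped if it is trivial. -/
theorem cons {i : ι} (h : HasHolonomy r g b d γ) (hr : r i a b) :
    HasHolonomy r g a d (coboundary (g i) a b * γ) := by
  obtain ⟨n, x, j, hx, rfl, rfl, rfl⟩ := h
  by_cases hab : a = x 0
  · subst hab
    exact ⟨n, x, j, hx, rfl, rfl, by simp⟩
  by_cases hi : 0 < n → i ≠ j 0
  · exact ⟨n + 1, _, _, hx.cons hr hab hi, rfl, rfl, rfl⟩
  obtain ⟨hn, rfl⟩ : 0 < n ∧ i = j 0 := by simpa using hi
  obtain ⟨n, rfl⟩ := Nat.exists_eq_succ_of_ne_zero hn.ne'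
  have hmerge : r (j 0) a (x 1) := htrans _ hr (hx.step 0 n.succ_pos)
  simp only [chainProd, ← mul_assoc, coboundary_mul_coboundary]
  by_cases hax : a = x 1
  · exact ⟨n, _, _, hx.tail, hax.symm, rfl, by simp [hax]⟩
  · exact ⟨n + 1, _, _, hx.tail.cons hmerge hax fun hn => hx.index 0 (by omega), rfl, rfl, rfl⟩

theorem single [Nonempty ι] {i : ι} (hr : r i a b) :
    HasHolonomy r g a b (coboundary (g i) a b) := by
  simpa using (HasHolonomy.refl r g b).cons htrans hr

theorem trans (h : HasHolonomy r g a b γ) (h' : HasHolonomy r g b d δ) :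
    HasHolonomy r g a d (γ * δ) := by
  obtain ⟨n, x, j, hx, rfl, rfl, rfl⟩ := h
  induction n generalizing x j with
  | zero => simpa [chainProd] using h'
  | succ n ih =>
    simpa [chainProd, mul_assoc] using (ih _ _ hx.tail h').cons htrans (hx.step 0 n.succ_pos)

theorem symm [Nonempty ι] (hsymm : ∀ i ⦃x y⦄, r i x y → r i y x) (h : HasHolonomy r g a b γ) :
    HasHolonomy r g b a γ⁻¹ := by
  obtain ⟨n, x, j, hx, rfl, rfl, rfl⟩ := h
  induction n generalizing x j with
  | zero => simpa [chainProd] using HasHolonomy.refl r g (x 0)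
  | succ n ih =>
    simpa [chainProd] using
      (ih _ _ hx.tail).trans htrans (.single htrans (hsymm _ (hx.step 0 n.succ_pos)))

end HasHolonomy

namespace IsFreeProduct

variable [MeasurableSpace X] {D : Set X} {R : X → X → Prop} {E : ι → Set X}
  {r : ι → X → X → Prop}

theorem trans (h : IsFreeProduct D R E r) {x y z : X} (hxy : R x y) (hyz : R y z) : R x z :=
  have ⟨hx, _, hgxy⟩ := (h.generates x y).1 hxy
  have ⟨_, hz, hgyz⟩ := (h.generates y z).1 hyz
  (h.generates x z).2 ⟨hx, hz, .trans _ _ _ hgxy hgyz⟩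

theorem equivalence (h : IsFreeProduct univ R E r) : Equivalence R where
  refl x := (h.generates x x).2 ⟨trivial, trivial, .refl x⟩
  symm {x y} hxy := (h.generates y x).2 ⟨trivial, trivial, .symm _ _ ((h.generates x y).1 hxy).2.2⟩
  trans := h.trans

theorem hasHolonomy_unique [Nonempty ι] (h : IsFreeProduct D R E r) {g : ι → X → G} {a b : X}
    {γ δ : G} (hγ : HasHolonomy r g a b γ) (hδ : HasHolonomy r g a b δ) : γ = δ := by
  obtain ⟨n, x, j, hx, hxa, hxn, hprod⟩ := hγ.trans (fun i => (h.factor i).trans)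
    (hδ.symm (fun i => (h.factor i).trans) fun i => (h.factor i).symm)
  rw [← mul_inv_eq_one, ← hprod]
  rcases n.eq_zero_or_pos with rfl | hn
  · rfl
  · obtain ⟨k, hk, hkk⟩ := h.reduced n x j hn hx.step hx.index (hxn.trans hxa.symm)
    exact absurd hkk (hx.ne k hk)

theorem exists_hasHolonomy [Nonempty ι] (h : IsFreeProduct D R E r) (g : ι → X → G) {a b : X}
    (hab : R a b) : ∃ γ, HasHolonomy r g a b γ := by
  have htrans := fun i => (h.factor i).trans
  have hgen := ((h.generates a b).1 hab).2.2
  clear hab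
  induction hgen with
  | rel x y hxy =>
    obtain ⟨i, hi⟩ := hxy
    exact ⟨_, .single htrans hi⟩
  | refl x => exact ⟨1, .refl r g x⟩
  | symm x y _ ih =>
    obtain ⟨γ, hγ⟩ := ih
    exact ⟨_, hγ.symm htrans fun i => (h.factor i).symm⟩
  | trans x y z _ _ ih₁ ih₂ =>
    obtain ⟨γ, hγ⟩ := ih₁
    obtain ⟨δ, hδ⟩ := ih₂
    exact ⟨_, hγ.trans htrans hδ⟩

theorem exists_isCocycle (h : IsFreeProduct D R E r) (g : ι → X → G) :
    ∃ c : X → X → G, IsCocycle R c ∧ ∀ i x y, r i x y → c x y = coboundary (g i) x y := by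
  rcases isEmpty_or_nonempty ι with hι | hι
  · exact ⟨fun _ _ => 1, by simp [IsCocycle], isEmptyElim⟩
  have htrans := fun i => (h.factor i).trans
  have hex : ∀ x y, ∃ γ, R x y → HasHolonomy r g x y γ := fun x y => by
    by_cases hxy : R x y
    · exact (h.exists_hasHolonomy g hxy).imp fun γ hγ _ => hγ
    · exact ⟨1, fun h => absurd h hxy⟩
  choose c hc using hex
  refine ⟨c, fun x y z hxy hyz => ?_, fun i x y hxy =>
    h.hasHolonomy_unique (hc x y (h.subrelation i x y hxy)) (.single htrans hxy)⟩
  exact h.hasHolonomy_unique (hc x z (h.trans hxy hyz)) ((hc x y hxy).trans htrans (hc y z hyz))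

end IsFreeProduct

theorem rel_of_reachable {R : X → X → Prop} (hR : Equivalence R) {H : SimpleGraph X}
    (hH : ∀ a b, H.Adj a b → R a b) {a b : X} (h : H.Reachable a b) : R a b := by
  obtain ⟨p⟩ := h
  induction p with
  | nil => exact hR.refl _
  | cons hadj _ ih => exact hR.trans (hH _ _ hadj) ih

theorem IsCocycle.eq_coboundary_of_reachable {R : X → X → Prop} {c : X → X → G}
    (hc : IsCocycle R c) (hR : Equivalence R) {H : SimpleGraph X} (hH : ∀ a b, H.Adj a b → R a b)
    {g : X → G} (hg : ∀ a b, H.Adj a b → c a b = coboundary g a b) {a b : X}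
    (h : H.Reachable a b) : c a b = coboundary g a b := by
  obtain ⟨p⟩ := h
  induction p with
  | nil => rw [hc.map_self (hR.refl _), coboundary_self]
  | cons hadj q ih =>
    rw [hc (hH _ _ hadj) (rel_of_reachable hR hH ⟨q⟩), ih, hg _ _ hadj, coboundary_mul_coboundary]

/-- The antisymmetrization of a labelling of oriented edges. -/
def skew (u : X → X → G) (a b : X) : G := u a b * (u b a)⁻¹

@[simp]
theorem skew_self (u : X → X → G) (a : X) : skew u a a = 1 := mul_inv_cancel _

@[simp]
theorem skew_inv (u : X → X → G) (a b : X) : (skew u a b)⁻¹ = skew u b a := by simp [skew]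

/-- A cocycle that is nontrivial on exactly one edge shows that this edge is a bridge. -/
theorem isAcyclic_of_exists_isCocycle {R : X → X → Prop} (hR : Equivalence R) {H : SimpleGraph X}
    (hH : ∀ a b, H.Adj a b → R a b)
    (hext : ∀ u : X → X → Multiplicative ℤ, ∃ c : X → X → Multiplicative ℤ, IsCocycle R c ∧
      ∀ a b, H.Adj a b → c a b = skew u a b) : H.IsAcyclic := by
  classical
  refine SimpleGraph.isAcyclic_iff_forall_adj_isBridge.2 fun v w hvw => ?_
  rw [SimpleGraph.isBridge_iff]
  intro hreach
  obtain ⟨c, hc, hcu⟩ := hext fun a b => if a = v ∧ b = w then Multiplicative.ofAdd 1 else 1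
  have hbridge : c v w = Multiplicative.ofAdd 1 := by simp [hcu v w hvw, skew, hvw.ne']
  have htrivial : ∀ a b, (H.deleteEdges {s(v, w)}).Adj a b →
      c a b = coboundary (fun _ => (1 : Multiplicative ℤ)) a b := fun a b hab => by
    obtain ⟨hab, hne⟩ := SimpleGraph.deleteEdges_adj.1 hab
    have hne : ¬ (a = v ∧ b = w) ∧ ¬ (a = w ∧ b = v) := by simpa using hne
    simp [hcu a b hab, skew, coboundary, hne.1, hne.2, and_comm (a := b = v)]
  have hone := hc.eq_coboundary_of_reachable hR
    (fun a b hab => hH a b (SimpleGraph.deleteEdges_adj.1 hab).1) htrivial hreach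
  simp [hbridge, coboundary] at hone

end Cocycles

/-! ### Retraction systems -/

section Saturation

variable {X : Type*} {R : X → X → Prop} {A : Set X}

theorem subset_saturation (hR : Equivalence R) : A ⊆ saturation R A :=
  fun a ha => ⟨a, ha, hR.refl a⟩

theorem mem_saturation_of_rel (hR : Equivalence R) {x y : X} (hx : x ∈ saturation R A)
    (hxy : R x y) : y ∈ saturation R A :=
  have ⟨a, ha, hax⟩ := hx
  ⟨a, ha, hR.trans hax hxy⟩

end Saturation

/-- A way of moving the `R`-saturation of `A` back onto `A` along the factors `r i`.

The map `proj` is the end result, and a point outside `A` has an `r i`-equivalent point of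
smaller `rank` with the same projection and the same `i`-retraction. The map `retract i` moves
each point within its `r i`-class onto a transversal-like subset, and `index i` numbers the
`r i`-classes in such a way that on the image of `retract i` inside the classes of a given number
`k` the map `proj` is injective, with inverse `lift k`. -/
structure RetractionSystem {X I : Type*} (R : X → X → Prop) (E : I → Set X)
    (r : I → X → X → Prop) (A : Set X) where
  rank : X → ℕ
  proj : X → X
  index : I → X → ℕ
  retract : I → X → X
  lift : ℕ → X → X
  proj_of_mem : ∀ ⦃x⦄, x ∈ A → proj x = x
  exists_step : ∀ ⦃x⦄, x ∈ saturation R A → x ∉ A →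
    ∃ i y, r i x y ∧ rank y < rank x ∧ proj y = proj x ∧ retract i y = retract i x
  rel_retract : ∀ ⦃i x⦄, x ∈ E i ∩ saturation R A → r i x (retract i x)
  retract_retract : ∀ ⦃i x⦄, x ∈ E i ∩ saturation R A → retract i (retract i x) = retract i x
  retract_of_mem : ∀ ⦃i x⦄, x ∈ E i ∩ A → retract i x = x
  index_eq : ∀ ⦃i x y⦄, r i x y → index i x = index i y
  index_of_mem : ∀ ⦃i x⦄, x ∈ E i ∩ A → index i x = 0
  lift_zero : lift 0 = id
  lift_proj : ∀ ⦃i x⦄, x ∈ E i ∩ saturation R A → retract i x = x →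
    lift (index i x) (proj x) = x

namespace RetractionSystem

variable {X I : Type*} {R : X → X → Prop} {E : I → Set X} {r : I → X → X → Prop} {A : Set X}
  (P : RetractionSystem R E r A)

/-- The part of the image of `retract i` that lies in the `r i`-classes with number `k`. -/
def piece (i : I) (k : ℕ) : Set X :=
  {x | x ∈ E i ∩ saturation R A ∧ P.retract i x = x ∧ P.index i x = k}

variable {P} in
theorem lift_proj_of_mem_piece {i : I} {k : ℕ} {x : X} (hx : x ∈ P.piece i k) :
    P.lift k (P.proj x) = x :=
  hx.2.2 ▸ P.lift_proj hx.1 hx.2.1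

/-- The bijection `P.lift k` from the projection of `P.piece i k` onto `P.piece i k`: the map `φ_k`
of the theorem. -/
def pieceEquiv (i : I) (k : ℕ) : PartialEquiv X X where
  toFun := P.lift k
  invFun := P.proj
  source := {a | P.lift k a ∈ P.piece i k ∧ P.proj (P.lift k a) = a}
  target := P.piece i k
  map_source' _ ha := ha.1
  map_target' x hx := by
    simp only [mem_ofPred_eq, lift_proj_of_mem_piece hx, hx, and_self]
  left_inv' _ ha := ha.2
  right_inv' _ hx := lift_proj_of_mem_piece hx

/-- The transport of `r i` from `P.piece i k` to a subset of `A`: the relation `𝒮_k` of the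
theorem. -/
def factor (i : I) (k : ℕ) : X → X → Prop :=
  conj (P.pieceEquiv i k) (restr (r i) (P.pieceEquiv i k).target)

/-- Each point of `E i` yields an edge from its projection to that of its `i`-retraction. -/
def edge (a b : X) : Prop :=
  ∃ i, ∃ x ∈ E i ∩ saturation R A, P.proj x = a ∧ P.proj (P.retract i x) = b

/-- The graph on `A` spanned by the edges that are not loops. -/
def graph : SimpleGraph X := .fromRel P.edge

/-- The relation on `A` whose classes are the connected components of `P.graph`: the relation
`𝒯` of the theorem. -/
def tree (a b : X) : Prop := a ∈ A ∧ b ∈ A ∧ P.graph.Reachable a b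

/-- The indices `K(i)` of the theorem. -/
def Index (i : I) : Type := {k : ℕ // (P.piece i k).Nonempty}

instance (i : I) : Countable (P.Index i) := inferInstanceAs (Countable {_k : ℕ // _})

/-- The domains of the relations `P.family j`. -/
def domain (j : Option (Σ i, P.Index i)) : Set X :=
  j.elim A fun p => (P.pieceEquiv p.1 p.2.1).source

/-- All the factors of the free product decomposition of `restr R A`, where `none` stands for
`P.tree`. -/
def family (j : Option (Σ i, P.Index i)) : X → X → Prop :=
  j.elim P.tree fun p => P.factor p.1 p.2.1

theorem factor_iff {i : I} {k : ℕ} {a b : X} :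
    P.factor i k a b ↔
      ∃ x ∈ P.piece i k, ∃ y ∈ P.piece i k, P.proj x = a ∧ P.proj y = b ∧ r i x y := by
  constructor
  · rintro ⟨ha, hb, -, -, hab⟩
    exact ⟨_, ha.1, _, hb.1, ha.2, hb.2, hab⟩
  · rintro ⟨x, hx, y, hy, rfl, rfl, hxy⟩
    refine ⟨(P.pieceEquiv i k).map_target hx, (P.pieceEquiv i k).map_target hy, ?_⟩
    change restr (r i) (P.piece i k) (P.lift k (P.proj x)) (P.lift k (P.proj y))
    rw [lift_proj_of_mem_piece hx, lift_proj_of_mem_piece hy]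
    exact ⟨hx, hy, hxy⟩

variable [MeasurableSpace X] (hfree : IsFreeProduct univ R E r)
include hfree

theorem retract_mem_piece {i : I} {x : X} (hx : x ∈ E i ∩ saturation R A) :
    P.retract i x ∈ P.piece i (P.index i x) :=
  have hrel := P.rel_retract hx
  ⟨⟨((hfree.factor i).mem_domain hrel).2,
    mem_saturation_of_rel hfree.equivalence hx.2 (hfree.subrelation _ _ _ hrel)⟩,
    P.retract_retract hx, (P.index_eq hrel).symm⟩

theorem proj_mem_and_rel_proj {x : X} (hx : x ∈ saturation R A) :
    P.proj x ∈ A ∧ R x (P.proj x) := by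
  have hR := hfree.equivalence
  induction h : P.rank x using Nat.strong_induction_on generalizing x with
  | _ n ih =>
    by_cases hxA : x ∈ A
    · exact (P.proj_of_mem hxA).symm ▸ ⟨hxA, hR.refl x⟩
    obtain ⟨i, y, hxy, hlt, hproj, -⟩ := P.exists_step hx hxA
    have hRxy := hfree.subrelation _ _ _ hxy
    obtain ⟨hA, hy⟩ := ih _ (h ▸ hlt) (mem_saturation_of_rel hR hx hRxy) rfl
    exact hproj ▸ ⟨hA, hR.trans hRxy hy⟩

theorem restr_proj {x y : X} (hx : x ∈ saturation R A) (hxy : R x y) :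
    restr R A (P.proj x) (P.proj y) := by
  have hR := hfree.equivalence
  obtain ⟨hxA, hx'⟩ := P.proj_mem_and_rel_proj hfree hx
  obtain ⟨hyA, hy'⟩ := P.proj_mem_and_rel_proj hfree (mem_saturation_of_rel hR hx hxy)
  exact ⟨hxA, hyA, hR.trans (hR.symm hx') (hR.trans hxy hy')⟩

theorem restr_of_factor {i : I} {k : ℕ} {a b : X} (h : P.factor i k a b) : restr R A a b := by
  obtain ⟨x, hx, y, -, rfl, rfl, hxy⟩ := P.factor_iff.1 h
  exact P.restr_proj hfree hx.1.2 (hfree.subrelation _ _ _ hxy)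

theorem restr_of_adj {a b : X} (h : P.graph.Adj a b) : restr R A a b := by
  have hedge : ∀ ⦃a b⦄, P.edge a b → restr R A a b := by
    rintro a b ⟨i, x, hx, rfl, rfl⟩
    exact P.restr_proj hfree hx.2 (hfree.subrelation _ _ _ (P.rel_retract hx))
  obtain ⟨-, h | h⟩ := (SimpleGraph.fromRel_adj _ _ _).1 h
  · exact hedge h
  · exact ⟨(hedge h).2.1, (hedge h).1, hfree.equivalence.symm (hedge h).2.2⟩

theorem restr_of_family {j : Option (Σ i, P.Index i)} {a b : X} (h : P.family j a b) :
    restr R A a b := by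
  rcases j with _ | ⟨i, k⟩
  · exact ⟨h.1, h.2.1, rel_of_reachable hfree.equivalence
      (fun _ _ hab => (P.restr_of_adj hfree hab).2.2) h.2.2⟩
  · exact P.restr_of_factor hfree h

section Cocycle

variable {G : Type*} [Group G]

theorem map_proj_eq_one {c : X → X → G} (hc : IsCocycle R c)
    (hstep : ∀ i x y, r i x y → P.proj y = P.proj x →
      P.retract i y = P.retract i x → c x y = 1) {x : X} (hx : x ∈ saturation R A) :
    c x (P.proj x) = 1 := by
  have hR := hfree.equivalence
  induction h : P.rank x using Nat.strong_induction_on generalizing x with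
  | _ n ih =>
    by_cases hxA : x ∈ A
    · rw [P.proj_of_mem hxA, hc.map_self (hR.refl x)]
    obtain ⟨i, y, hxy, hlt, hproj, hret⟩ := P.exists_step hx hxA
    have hRxy := hfree.subrelation _ _ _ hxy
    have hy := mem_saturation_of_rel hR hx hRxy
    rw [← hproj, hc hRxy (P.proj_mem_and_rel_proj hfree hy).2, hstep i x y hxy hproj hret,
      ih _ (h ▸ hlt) hy rfl, one_mul]

theorem map_proj_proj {c : X → X → G} (hc : IsCocycle R c)
    (hproj : ∀ ⦃x⦄, x ∈ saturation R A → c x (P.proj x) = 1) {x y : X}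
    (hx : x ∈ saturation R A) (hxy : R x y) : c (P.proj x) (P.proj y) = c x y := by
  have hR := hfree.equivalence
  have hy := mem_saturation_of_rel hR hx hxy
  have hx' := (P.proj_mem_and_rel_proj hfree hx).2
  have hy' := (P.proj_mem_and_rel_proj hfree hy).2
  rw [hc (hR.symm hx') (hR.trans hxy hy'), hc hxy hy', hc.map_swap hR hx', hproj hx, hproj hy,
    inv_one, one_mul, mul_one]

/-- The potential on the factor `r i` at `x` is prescribed along the path from the projection of
`x` to that of its retraction, followed by the given potential at the latter point. This makes the
cocycle trivial on every step of the projection. -/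
theorem exists_isCocycle (g : I → ℕ → X → G) (u : X → X → G) :
    ∃ c, IsCocycle R c ∧
      (∀ i k a b, P.factor i k a b → c a b = coboundary (g i k) a b) ∧
      ∀ a b, P.graph.Adj a b → c a b = skew u a b := by
  have hR := hfree.equivalence
  obtain ⟨c, hc, hcr⟩ := hfree.exists_isCocycle fun i x =>
    skew u (P.proj x) (P.proj (P.retract i x)) * g i (P.index i x) (P.proj (P.retract i x))
  have hproj : ∀ ⦃x⦄, x ∈ saturation R A → c x (P.proj x) = 1 := fun x =>
    P.map_proj_eq_one hfree hc fun i x y hxy hp hret => by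
      rw [hcr i x y hxy, coboundary, hp, hret, P.index_eq hxy, mul_inv_cancel]
  have hedge : ∀ a b, P.edge a b → c a b = skew u a b := by
    rintro _ _ ⟨i, x, hx, rfl, rfl⟩
    have hrel := P.rel_retract hx
    rw [P.map_proj_proj hfree hc hproj hx.2 (hfree.subrelation _ _ _ hrel), hcr i _ _ hrel,
      coboundary, P.retract_retract hx, ← P.index_eq hrel, skew_self, one_mul,
      mul_inv_cancel_right]
  refine ⟨c, hc, fun i k a b h => ?_, fun a b h => ?_⟩
  · obtain ⟨x, ⟨hx, hxr, hxk⟩, y, ⟨-, hyr, hyk⟩, rfl, rfl, hxy⟩ := P.factor_iff.1 h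
    rw [P.map_proj_proj hfree hc hproj hx.2 (hfree.subrelation _ _ _ hxy), hcr i _ _ hxy,
      coboundary, hxr, hyr, hxk, hyk, skew_self, skew_self, one_mul, one_mul, coboundary]
  · obtain ⟨-, hab | hba⟩ := (SimpleGraph.fromRel_adj _ _ _).1 h
    · exact hedge a b hab
    · rw [hc.map_swap hR (P.restr_of_adj hfree h.symm).2.2, hedge b a hba, skew_inv]

theorem exists_isCocycle_family (g : Option (Σ i, P.Index i) → X → G) :
    ∃ c, IsCocycle R c ∧ ∀ j a b, P.family j a b → c a b = coboundary (g j) a b := by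
  classical
  have hR := hfree.equivalence
  obtain ⟨c, hc, hcf, hcu⟩ := P.exists_isCocycle hfree
    (fun i k => if hk : (P.piece i k).Nonempty then g (some ⟨i, k, hk⟩) else 1)
    (fun a _ => g none a)
  refine ⟨c, hc, ?_⟩
  rintro (_ | ⟨i, k, hk⟩) a b hab
  · exact hc.eq_coboundary_of_reachable hR (fun _ _ h => (P.restr_of_adj hfree h).2.2) hcu hab.2.2
  · rw [hcf i k a b hab, dif_pos hk]

theorem isAcyclic_graph : P.graph.IsAcyclic :=
  isAcyclic_of_exists_isCocycle hfree.equivalence (fun _ _ h => (P.restr_of_adj hfree h).2.2)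
    fun u => (P.exists_isCocycle hfree (fun _ _ _ => 1) u).imp fun _ h => ⟨h.1, h.2.2⟩

end Cocycle

theorem eqvGen_proj_of_factor {i : I} {x y : X} (hx : x ∈ saturation R A) (hxy : r i x y) :
    Relation.EqvGen (fun a b => ∃ j, P.family j a b) (P.proj x) (P.proj y) := by
  have hedge : ∀ ⦃z⦄, z ∈ E i ∩ saturation R A →
      Relation.EqvGen (fun a b => ∃ j, P.family j a b) (P.proj z) (P.proj (P.retract i z)) := by
    intro z hz
    obtain ⟨ha, hb, -⟩ := P.restr_proj hfree hz.2 (hfree.subrelation _ _ _ (P.rel_retract hz))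
    refine .rel _ _ ⟨none, ha, hb, ?_⟩
    by_cases hne : P.proj z = P.proj (P.retract i z)
    · rw [hne]
    · exact SimpleGraph.Adj.reachable
        ((SimpleGraph.fromRel_adj _ _ _).2 ⟨hne, .inl ⟨i, z, hz, rfl, rfl⟩⟩)
  have hxE : x ∈ E i ∩ saturation R A := ⟨((hfree.factor i).mem_domain hxy).1, hx⟩
  have hyE : y ∈ E i ∩ saturation R A := ⟨((hfree.factor i).mem_domain hxy).2,
    mem_saturation_of_rel hfree.equivalence hx (hfree.subrelation _ _ _ hxy)⟩
  have hxp := P.retract_mem_piece hfree hxE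
  have hyp := P.index_eq hxy ▸ P.retract_mem_piece hfree hyE
  have hret : r i (P.retract i x) (P.retract i y) :=
    (hfree.factor i).trans ((hfree.factor i).symm (P.rel_retract hxE))
      ((hfree.factor i).trans hxy (P.rel_retract hyE))
  exact .trans _ _ _ (hedge hxE) (.trans _ _ _ (.rel _ _ ⟨some ⟨i, _, _, hxp⟩,
    P.factor_iff.2 ⟨_, hxp, _, hyp, rfl, rfl, hret⟩⟩) (.symm _ _ (hedge hyE)))

theorem eqvGen_proj {x y : X} (hx : x ∈ saturation R A) (hxy : R x y) :
    Relation.EqvGen (fun a b => ∃ j, P.family j a b) (P.proj x) (P.proj y) := by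
  have hR := hfree.equivalence
  have hrel : ∀ x y, Relation.EqvGen (fun a b => ∃ i, r i a b) x y → R x y := fun x y h =>
    (hfree.generates x y).2 ⟨trivial, trivial, h⟩
  have hgen := ((hfree.generates x y).1 hxy).2.2
  clear hxy
  induction hgen with
  | rel x y h => exact h.elim fun i hi => P.eqvGen_proj_of_factor hfree hx hi
  | refl x => exact .refl _
  | symm x y h ih =>
    exact .symm _ _ (ih (mem_saturation_of_rel hR hx (hR.symm (hrel x y h))))
  | trans x y z h _ ih₁ ih₂ =>
    exact .trans _ _ _ (ih₁ hx) (ih₂ (mem_saturation_of_rel hR hx (hrel x y h)))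

theorem generates (x y : X) : restr R A x y ↔
    x ∈ A ∧ y ∈ A ∧ Relation.EqvGen (fun a b => ∃ j, P.family j a b) x y := by
  have hR := hfree.equivalence
  refine ⟨fun ⟨hx, hy, hxy⟩ => ⟨hx, hy, ?_⟩, fun ⟨hx, hy, hxy⟩ => ⟨hx, hy, ?_⟩⟩
  · simpa only [P.proj_of_mem hx, P.proj_of_mem hy] using
      P.eqvGen_proj hfree (subset_saturation hR hx) hxy
  · exact hR.eqvGen_iff.1 (hxy.mono fun a b ⟨j, hj⟩ => (P.restr_of_family hfree hj).2.2)

theorem isFreeProduct (hfam : ∀ j, IsCountableBorelEquivOn (P.domain j) (P.family j)) :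
    IsFreeProduct A (restr R A) P.domain P.family where
  factor := hfam
  subrelation _ _ _ := P.restr_of_family hfree
  generates := P.generates hfree
  reduced n x j hn hstep hindex hclosed := by
    by_contra! hne
    obtain ⟨c, hc, hcf⟩ := P.exists_isCocycle_family hfree freePotential
    exact IsReducedChain.ne_of_isCocycle hc hfree.equivalence
      (fun j a b h => (P.restr_of_family hfree h).2.2) hcf ⟨hstep, hne, hindex⟩ hn hclosed

end RetractionSystem

/-! ### Borel selection -/

section FirstIndex

variable {X : Type*} {B : ℕ → Set X} {x : X}

/-- The least `n` with `x ∈ B n`, or `0` if there is none. -/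
noncomputable def firstIndex (B : ℕ → Set X) (x : X) : ℕ := sInf {n | x ∈ B n}

theorem mem_firstIndex (h : ∃ n, x ∈ B n) : x ∈ B (firstIndex B x) := Nat.sInf_mem h

theorem firstIndex_le {n : ℕ} (h : x ∈ B n) : firstIndex B x ≤ n := Nat.sInf_le h

theorem firstIndex_eq_zero (h : x ∈ B 0) : firstIndex B x = 0 := Nat.le_zero.1 (firstIndex_le h)

theorem measurable_firstIndex [MeasurableSpace X] (hB : ∀ n, MeasurableSet (B n)) :
    Measurable (firstIndex B) := by
  refine measurable_of_Iic fun n => ?_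
  have hle : firstIndex B ⁻¹' Iic n = (⋃ m ∈ Iic n, B m) ∪ (⋃ m, B m)ᶜ := by
    ext x
    simp only [mem_preimage, mem_Iic, mem_union, mem_iUnion, exists_prop, mem_compl_iff]
    refine ⟨fun h => ?_, ?_⟩
    · by_cases hx : ∃ m, x ∈ B m
      · exact .inl ⟨_, h, mem_firstIndex hx⟩
      · exact .inr hx
    · rintro (⟨m, hm, hx⟩ | hx)
      · exact (firstIndex_le hx).trans hm
      · simp [firstIndex, not_exists.1 hx]
  rw [hle]
  exact (MeasurableSet.biUnion (to_countable _) fun m _ => hB m).union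
    (MeasurableSet.iUnion hB).compl

theorem measurable_eval_index [MeasurableSpace X] {f : ℕ → X → X} {k : X → ℕ}
    (hf : ∀ n, Measurable (f n)) (hk : Measurable k) : Measurable fun x => f (k x) x :=
  (measurable_from_prod_countable_right (f := fun q : ℕ × X => f q.1 q.2) hf).comp
    (hk.prodMk measurable_id)

end FirstIndex

section FirstHit

variable {X : Type*} {p : X → X} {T : Set X} {x : X}

/-- The first point of the orbit `x, p x, p (p x), …` that lies in `T`, or `x` if there is none. -/
noncomputable def firstHit (p : X → X) (T : Set X) (x : X) : X :=
  p^[firstIndex (fun n => p^[n] ⁻¹' T) x] x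

theorem firstHit_of_mem (hx : x ∈ T) : firstHit p T x = x := by
  rw [firstHit, firstIndex_eq_zero (show x ∈ p^[0] ⁻¹' T from hx), Function.iterate_zero_apply]

theorem firstHit_mem (h : ∃ n, p^[n] x ∈ T) : firstHit p T x ∈ T :=
  mem_firstIndex (B := fun n => p^[n] ⁻¹' T) h

theorem firstHit_map (hx : x ∉ T) (h : ∃ n, p^[n] x ∈ T) :
    firstHit p T (p x) = firstHit p T x := by
  have hpos : 1 ≤ sInf {n | p^[n] x ∈ T} := Nat.one_le_iff_ne_zero.2 fun h0 => by
    have hmem : p^[sInf {n | p^[n] x ∈ T}] x ∈ T := Nat.sInf_mem h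
    exact hx (by rwa [h0] at hmem)
  change p^[sInf {n | p^[n + 1] x ∈ T}] (p x) = p^[sInf {n | p^[n] x ∈ T}] x
  rw [← Nat.sInf_add hpos, Function.iterate_succ_apply]

theorem exists_iterate_mem_and_rel_firstHit {S : Set X} {s : X → X → Prop} {rank : X → ℕ}
    (hrefl : ∀ x ∈ S, s x x) (htrans : ∀ ⦃x y z⦄, s x y → s y z → s x z)
    (hstep : ∀ x ∈ S, x ∉ T → p x ∈ S ∧ rank (p x) < rank x ∧ s x (p x)) (hx : x ∈ S) :
    (∃ n, p^[n] x ∈ T) ∧ s x (firstHit p T x) := by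
  induction h : rank x using Nat.strong_induction_on generalizing x with
  | _ n ih =>
    by_cases hxT : x ∈ T
    · exact ⟨⟨0, hxT⟩, (firstHit_of_mem hxT).symm ▸ hrefl x hx⟩
    obtain ⟨hpx, hlt, hs⟩ := hstep x hx hxT
    obtain ⟨⟨m, hm⟩, hrel⟩ := ih _ (h ▸ hlt) hpx rfl
    have hex : ∃ n, p^[n] x ∈ T := ⟨m + 1, hm⟩
    exact ⟨hex, htrans hs (firstHit_map hxT hex ▸ hrel)⟩

theorem measurable_firstHit [MeasurableSpace X] (hp : Measurable p) (hT : MeasurableSet T) :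
    Measurable (firstHit p T) :=
  measurable_eval_index hp.iterate (measurable_firstIndex fun n => hp.iterate n hT)

end FirstHit

/-- The maps `f n` are Borel and enumerate the classes of `R`, the first of them being the
identity. -/
structure IsEnumeration {X : Type*} [MeasurableSpace X] (R : X → X → Prop) (f : ℕ → X → X) :
    Prop where
  measurable : ∀ n, Measurable (f n)
  zero : f 0 = id
  rel_iff : ∀ ⦃x y⦄, R x y ↔ ∃ n, f n x = y

theorem IsEnumeration.of_measurable {X : Type*} [MeasurableSpace X] {R : X → X → Prop}
    {f : ℕ → X → X} (hR : Equivalence R) (hf : ∀ n, Measurable (f n))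
    (hfR : ∀ x y, R x y ↔ ∃ n, f n x = y) :
    IsEnumeration R fun n => Nat.casesOn n id f where
  measurable := by
    rintro (_ | n)
    exacts [measurable_id, hf n]
  zero := rfl
  rel_iff x y := by
    refine ⟨fun h => ((hfR x y).1 h).imp' Nat.succ fun _ hn => hn, ?_⟩
    rintro ⟨_ | n, hn⟩
    exacts [hn ▸ hR.refl x, (hfR x y).2 ⟨n, hn⟩]

theorem IsCountableBorelEquivOn.measurableSet_rel {X Y : Type*} [MeasurableSpace X]
    [MeasurableSpace Y] {D : Set X} {s : X → X → Prop} (hs : IsCountableBorelEquivOn D s)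
    {F G : Y → X} (hF : Measurable F) (hG : Measurable G) : MeasurableSet {y | s (F y) (G y)} :=
  (hF.prodMk hG) hs.measurableSet_graph

section Selection

variable {X : Type*} {f : ℕ → X → X} {s : X → X → Prop} {W : ℕ → Set X} {x y : X}

/-- The number of the first of the sets `W k` that meets the `s`-class of `x`. -/
noncomputable def classIndex (s : X → X → Prop) (W : ℕ → Set X) : X → ℕ :=
  firstIndex fun k => saturation s (W k)

/-- A point of the `s`-class of `x` in the first of the sets `W k` that meets this class. -/
noncomputable def select (f : ℕ → X → X) (s : X → X → Prop) (W : ℕ → Set X) (x : X) : X :=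
  f (firstIndex (fun m => {x | s x (f m x) ∧ f m x ∈ W (classIndex s W x)}) x) x

variable [MeasurableSpace X] {R : X → X → Prop} {D : Set X}

theorem IsCountableBorelEquivOn.mem_saturation_iff (hs : IsCountableBorelEquivOn D s)
    (B : Set X) (hxy : s x y) : x ∈ saturation s B ↔ y ∈ saturation s B :=
  ⟨fun ⟨b, hb, h⟩ => ⟨b, hb, hs.trans h hxy⟩, fun ⟨b, hb, h⟩ => ⟨b, hb, hs.trans h (hs.symm hxy)⟩⟩

theorem IsCountableBorelEquivOn.classIndex_eq (hs : IsCountableBorelEquivOn D s) (hxy : s x y) :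
    classIndex s W x = classIndex s W y := by
  simp only [classIndex, firstIndex, hs.mem_saturation_iff _ hxy]

namespace IsEnumeration

variable (hf : IsEnumeration R f) (hsR : ∀ x y, s x y → R x y) (hs : IsCountableBorelEquivOn D s)
include hf

theorem select_of_mem (hx : s x x) (hxW : x ∈ W (classIndex s W x)) : select f s W x = x := by
  rw [select, firstIndex_eq_zero (by simpa only [mem_ofPred_eq, hf.zero] using ⟨hx, hxW⟩), hf.zero,
    id]

include hsR hs

theorem rel_select (hx : ∃ k, x ∈ saturation s (W k)) :
    s x (select f s W x) ∧ select f s W x ∈ W (classIndex s W x) := by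
  obtain ⟨z, hz, hzx⟩ := mem_firstIndex hx
  obtain ⟨m, rfl⟩ := hf.rel_iff.1 (hsR _ _ (hs.symm hzx))
  exact mem_firstIndex (B := fun m => {x | s x (f m x) ∧ f m x ∈ W (classIndex s W x)})
    ⟨m, hs.symm hzx, hz⟩

theorem measurableSet_saturation {B : Set X} (hB : MeasurableSet B) :
    MeasurableSet (saturation s B) := by
  have heq : saturation s B = ⋃ n, f n ⁻¹' B ∩ {x | s (f n x) x} := by
    ext x
    simp only [mem_iUnion]
    refine ⟨fun ⟨z, hz, hzx⟩ => ?_, fun ⟨n, hn, hnx⟩ => ⟨_, hn, hnx⟩⟩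
    obtain ⟨n, rfl⟩ := hf.rel_iff.1 (hsR _ _ (hs.symm hzx))
    exact ⟨n, hz, hzx⟩
  rw [heq]
  exact .iUnion fun n =>
    (hf.measurable n hB).inter (hs.measurableSet_rel (hf.measurable n) measurable_id)

theorem measurable_classIndex (hW : ∀ k, MeasurableSet (W k)) : Measurable (classIndex s W) :=
  measurable_firstIndex fun k => hf.measurableSet_saturation hsR hs (hW k)

theorem measurable_select (hW : ∀ k, MeasurableSet (W k)) : Measurable (select f s W) := by
  have hmem : ∀ m, MeasurableSet {x | f m x ∈ W (classIndex s W x)} := fun m => by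
    have heq : {x | f m x ∈ W (classIndex s W x)} =
        ⋃ k, f m ⁻¹' W k ∩ classIndex s W ⁻¹' {k} := by
      ext x
      simp
    exact heq ▸ .iUnion fun k => (hf.measurable m (hW k)).inter
      (hf.measurable_classIndex hsR hs hW (measurableSet_singleton k))
  exact measurable_eval_index hf.measurable (measurable_firstIndex fun m =>
    (hs.measurableSet_rel measurable_id (hf.measurable m)).inter (hmem m))

end IsEnumeration

end Selection

section Parent

variable {X I : Type*} [MeasurableSpace X] {R : X → X → Prop} {E : I → Set X}
  {r : I → X → X → Prop} {A : Set X} {f : ℕ → X → X}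

/-- The points that a chain of `n` steps in the relations `r i` joins to `A`. -/
def level (r : I → X → X → Prop) (A : Set X) : ℕ → Set X
  | 0 => A
  | n + 1 => ⋃ i, saturation (r i) (level r A n)

/-- The distance to `A` along the relations `r i`. -/
noncomputable def distance (r : I → X → X → Prop) (A : Set X) : X → ℕ := firstIndex (level r A)

/-- The first point in the enumeration `f` of the class of `x` that is closer to `A` and in a
common `r i`-class with `x`. -/
noncomputable def parent (f : ℕ → X → X) (r : I → X → X → Prop) (A : Set X) (x : X) : X :=
  f (firstIndex (fun m => {x | (∃ i, r i x (f m x)) ∧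
    distance r A (f m x) < distance r A x}) x) x

theorem IsFreeProduct.exists_mem_level (hfree : IsFreeProduct univ R E r) {x : X}
    (hx : x ∈ saturation R A) : ∃ n, x ∈ level r A n := by
  obtain ⟨a, ha, hax⟩ := hx
  have hQ : Equivalence fun x y => (∃ n, x ∈ level r A n) ↔ ∃ n, y ∈ level r A n :=
    ⟨fun _ => .rfl, .symm, .trans⟩
  have hstep : ∀ x y, (∃ i, r i x y) → (∃ n, x ∈ level r A n) → ∃ n, y ∈ level r A n :=
    fun x y ⟨i, hxy⟩ ⟨n, hn⟩ => ⟨n + 1, mem_iUnion.2 ⟨i, x, hn, hxy⟩⟩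
  refine (hQ.eqvGen_iff.1 (((hfree.generates a x).1 hax).2.2.mono fun x y hxy => ?_)).1 ⟨0, ha⟩
  exact ⟨hstep x y hxy, hstep y x (hxy.imp fun i => @(hfree.factor i).symm x y)⟩

namespace IsEnumeration

variable (hf : IsEnumeration R f) (hfree : IsFreeProduct univ R E r)
include hf hfree

theorem rel_parent {x : X} (hx : x ∈ saturation R A) (hxA : x ∉ A) :
    (∃ i, r i x (parent f r A x)) ∧ distance r A (parent f r A x) < distance r A x := by
  have hmem : x ∈ level r A (distance r A x) := mem_firstIndex (hfree.exists_mem_level hx)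
  obtain ⟨n, hn⟩ : ∃ n, distance r A x = n + 1 :=
    Nat.exists_eq_succ_of_ne_zero fun h0 => hxA (by rwa [h0] at hmem)
  rw [hn] at hmem
  obtain ⟨i, y, hy, hyx⟩ := mem_iUnion.1 hmem
  have hxy := (hfree.factor i).symm hyx
  obtain ⟨m, rfl⟩ := hf.rel_iff.1 (hfree.subrelation _ _ _ hxy)
  exact mem_firstIndex (B := fun m => {x | (∃ i, r i x (f m x)) ∧
    distance r A (f m x) < distance r A x})
    ⟨m, ⟨i, hxy⟩, hn ▸ Nat.lt_succ_of_le (firstIndex_le hy)⟩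

variable [Countable I] (hA : MeasurableSet A)
include hA

theorem measurable_distance : Measurable (distance r A) := by
  refine measurable_firstIndex fun n => ?_
  induction n with
  | zero => exact hA
  | succ n ih => exact .iUnion fun i =>
      hf.measurableSet_saturation (hfree.subrelation i) (hfree.factor i) ih

theorem measurable_parent : Measurable (parent f r A) := by
  have hd := hf.measurable_distance hfree hA
  have hrel : ∀ m, MeasurableSet {x | ∃ i, r i x (f m x)} := fun m => by
    rw [ofPred_exists]
    exact .iUnion fun i => (hfree.factor i).measurableSet_rel measurable_id (hf.measurable m)
  exact measurable_eval_index hf.measurable (measurable_firstIndex fun m =>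
    (hrel m).inter (measurableSet_lt (hd.comp (hf.measurable m)) hd))

end IsEnumeration

end Parent

/-! ### The Borel retraction system -/

section Construction

variable {X I : Type*} {R : X → X → Prop} {E : I → Set X} {r : I → X → X → Prop} {A : Set X}
  {f : ℕ → X → X}

/-- The map that follows the parents of a point down to `A`. -/
noncomputable def projection (f : ℕ → X → X) (r : I → X → X → Prop) (A : Set X) : X → X :=
  firstHit (parent f r A) A

/-- The points at which the path to `A` along parents leaves its class of the `i`-th factor. -/
def exitSet (f : ℕ → X → X) (R : X → X → Prop) (E : I → Set X) (r : I → X → X → Prop) (A : Set X)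
    (i : I) : Set X :=
  {x | x ∈ E i ∩ saturation R A ∧ (x ∈ A ∨ ¬ r i x (parent f r A x))}

/-- The exit points that `f k` recovers from their projections. -/
def sheet (f : ℕ → X → X) (R : X → X → Prop) (E : I → Set X) (r : I → X → X → Prop) (A : Set X)
    (i : I) (k : ℕ) : Set X :=
  {x | x ∈ exitSet f R E r A i ∧ f k (projection f r A x) = x}

/-- Moves a point to where its path to `A` leaves its class of the `i`-th factor, and from there to
a point of this class in the first sheet that meets the class. -/
noncomputable def retraction (f : ℕ → X → X) (R : X → X → Prop) (E : I → Set X)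
    (r : I → X → X → Prop) (A : Set X) (i : I) (x : X) : X :=
  select f (r i) (sheet f R E r A i) (firstHit (parent f r A) (exitSet f R E r A i) x)

variable [MeasurableSpace X]

namespace IsEnumeration

variable (hf : IsEnumeration R f) (hfree : IsFreeProduct univ R E r)
include hf hfree

theorem exists_iterate_parent_mem {x : X} (hx : x ∈ saturation R A) :
    (∃ n, (parent f r A)^[n] x ∈ A) ∧ R x (projection f r A x) := by
  have hR := hfree.equivalence
  refine exists_iterate_mem_and_rel_firstHit (rank := distance r A) (fun x _ => hR.refl x)
    (fun _ _ _ => hR.trans) (fun x hx hxA => ?_) hx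
  obtain ⟨⟨i, hi⟩, hlt⟩ := hf.rel_parent hfree hx hxA
  have hrel := hfree.subrelation _ _ _ hi
  exact ⟨mem_saturation_of_rel hR hx hrel, hlt, hrel⟩

theorem exists_iterate_parent_mem_exitSet {i : I} {x : X} (hx : x ∈ E i ∩ saturation R A) :
    (∃ n, (parent f r A)^[n] x ∈ exitSet f R E r A i) ∧
      r i x (firstHit (parent f r A) (exitSet f R E r A i) x) := by
  refine exists_iterate_mem_and_rel_firstHit (rank := distance r A)
    (fun x hx => (hfree.factor i).refl hx.1) (hfree.factor i).trans (fun x hx hxe => ?_) hx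
  have hxA : x ∉ A := fun h => hxe ⟨hx, .inl h⟩
  have hrel : r i x (parent f r A x) := by
    by_contra h
    exact hxe ⟨hx, .inr h⟩
  exact ⟨⟨((hfree.factor i).mem_domain hrel).2,
    mem_saturation_of_rel hfree.equivalence hx.2 (hfree.subrelation _ _ _ hrel)⟩,
    (hf.rel_parent hfree hx.2 hxA).2, hrel⟩

theorem exists_mem_saturation_sheet {i : I} {x : X} (hx : x ∈ E i ∩ saturation R A) :
    ∃ k, x ∈ saturation (r i) (sheet f R E r A i k) := by
  obtain ⟨hex, hrel⟩ := hf.exists_iterate_parent_mem_exitSet hfree hx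
  have hy := firstHit_mem hex
  obtain ⟨k, hk⟩ := hf.rel_iff.1
    (hfree.equivalence.symm (hf.exists_iterate_parent_mem hfree hy.1.2).2)
  exact ⟨k, _, ⟨hy, hk⟩, (hfree.factor i).symm hrel⟩

theorem rel_retraction {i : I} {x : X} (hx : x ∈ E i ∩ saturation R A) :
    r i x (retraction f R E r A i x) ∧
      retraction f R E r A i x ∈ sheet f R E r A i (classIndex (r i) (sheet f R E r A i) x) := by
  obtain ⟨hex, hrel⟩ := hf.exists_iterate_parent_mem_exitSet hfree hx
  obtain ⟨hsel, hmem⟩ := hf.rel_select (hfree.subrelation i) (hfree.factor i)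
    (hf.exists_mem_saturation_sheet hfree (firstHit_mem hex).1)
  exact ⟨(hfree.factor i).trans hrel hsel, (hfree.factor i).classIndex_eq hrel ▸ hmem⟩

theorem retraction_of_mem {i : I} {x : X}
    (hx : x ∈ sheet f R E r A i (classIndex (r i) (sheet f R E r A i) x)) :
    retraction f R E r A i x = x := by
  rw [retraction, firstHit_of_mem hx.1, hf.select_of_mem ((hfree.factor i).refl hx.1.1.1) hx]

theorem retraction_retraction {i : I} {x : X} (hx : x ∈ E i ∩ saturation R A) :
    retraction f R E r A i (retraction f R E r A i x) = retraction f R E r A i x := by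
  obtain ⟨hrel, hmem⟩ := hf.rel_retraction hfree hx
  exact hf.retraction_of_mem hfree ((hfree.factor i).classIndex_eq hrel ▸ hmem)

theorem classIndex_sheet_of_mem {i : I} {x : X} (hx : x ∈ E i ∩ A) :
    x ∈ sheet f R E r A i 0 ∧ classIndex (r i) (sheet f R E r A i) x = 0 := by
  have hmem : x ∈ sheet f R E r A i 0 :=
    ⟨⟨⟨hx.1, subset_saturation hfree.equivalence hx.2⟩, .inl hx.2⟩,
      by rw [projection, firstHit_of_mem hx.2, hf.zero, id]⟩
  exact ⟨hmem, firstIndex_eq_zero ⟨x, hmem, (hfree.factor i).refl hx.1⟩⟩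

theorem exists_parent_step {x : X} (hx : x ∈ saturation R A) (hxA : x ∉ A) :
    ∃ i y, r i x y ∧ distance r A y < distance r A x ∧ projection f r A y = projection f r A x ∧
      retraction f R E r A i y = retraction f R E r A i x := by
  obtain ⟨⟨i, hi⟩, hlt⟩ := hf.rel_parent hfree hx hxA
  have hexit : x ∉ exitSet f R E r A i := fun h => h.2.elim hxA fun h => h hi
  have hxE : x ∈ E i ∩ saturation R A := ⟨((hfree.factor i).mem_domain hi).1, hx⟩
  exact ⟨i, parent f r A x, hi, hlt, firstHit_map hxA (hf.exists_iterate_parent_mem hfree hx).1,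
    congrArg (select f (r i) (sheet f R E r A i))
      (firstHit_map hexit (hf.exists_iterate_parent_mem_exitSet hfree hxE).1)⟩

/-- The retraction system given by parents, sheets and the enumeration `f`. -/
noncomputable def retractionSystem (A : Set X) : RetractionSystem R E r A where
  rank := distance r A
  proj := projection f r A
  index i := classIndex (r i) (sheet f R E r A i)
  retract := retraction f R E r A
  lift := f
  proj_of_mem _ := firstHit_of_mem
  exists_step _ := hf.exists_parent_step hfree
  rel_retract _ _ hx := (hf.rel_retraction hfree hx).1
  retract_retract _ _ := hf.retraction_retraction hfree
  retract_of_mem _ _ hx := by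
    obtain ⟨hmem, hzero⟩ := hf.classIndex_sheet_of_mem hfree hx
    exact hf.retraction_of_mem hfree (hzero.symm ▸ hmem)
  index_eq i _ _ := (hfree.factor i).classIndex_eq
  index_of_mem _ _ hx := (hf.classIndex_sheet_of_mem hfree hx).2
  lift_zero := hf.zero
  lift_proj _ x hx hret := by
    have hmem := (hf.rel_retraction hfree hx).2
    rw [hret] at hmem
    exact hmem.2

end IsEnumeration

end Construction

/-- All the data of the retraction system are Borel. -/
structure RetractionSystem.IsBorel {X I : Type*} [MeasurableSpace X] {R : X → X → Prop}
    {E : I → Set X} {r : I → X → X → Prop} {A : Set X} (P : RetractionSystem R E r A) : Prop where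
  measurable_proj : Measurable P.proj
  measurable_index : ∀ i, Measurable (P.index i)
  measurable_retract : ∀ i, Measurable (P.retract i)
  measurable_lift : ∀ k, Measurable (P.lift k)

namespace IsEnumeration

variable {X I : Type*} [MeasurableSpace X] {R : X → X → Prop} {E : I → Set X}
  {r : I → X → X → Prop} {A : Set X} {f : ℕ → X → X} (hf : IsEnumeration R f)
include hf

theorem measurable_projection [Countable I] (hfree : IsFreeProduct univ R E r)
    (hA : MeasurableSet A) : Measurable (projection f r A) :=
  measurable_firstHit (hf.measurable_parent hfree hA) hA

variable [MeasurableEq X]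

theorem isCountableBorelEquivOn (hR : Equivalence R) : IsCountableBorelEquivOn univ R where
  measurableSet_domain := .univ
  measurableSet_graph := by
    simp only [hf.rel_iff, ofPred_exists]
    exact .iUnion fun n => measurableSet_eq_fun ((hf.measurable n).comp measurable_fst)
      measurable_snd
  mem_domain _ _ _ := ⟨trivial, trivial⟩
  refl x _ := hR.refl x
  symm _ _ := hR.symm
  trans _ _ _ := hR.trans
  countable_class x := by
    simp only [hf.rel_iff]
    exact countable_range fun n => f n x

variable (hfree : IsFreeProduct univ R E r) (hA : MeasurableSet A)
include hfree hA

theorem measurableSet_inter_saturation (i : I) : MeasurableSet (E i ∩ saturation R A) :=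
  (hfree.factor i).measurableSet_domain.inter (hf.measurableSet_saturation (fun _ _ => id)
    (hf.isCountableBorelEquivOn hfree.equivalence) hA)

variable [Countable I]

theorem measurableSet_exitSet (i : I) : MeasurableSet (exitSet f R E r A i) :=
  (hf.measurableSet_inter_saturation hfree hA i).inter (hA.union
    ((hfree.factor i).measurableSet_rel measurable_id (hf.measurable_parent hfree hA)).compl)

theorem measurableSet_sheet (i : I) (k : ℕ) : MeasurableSet (sheet f R E r A i k) :=
  (hf.measurableSet_exitSet hfree hA i).inter (measurableSet_eq_fun
    ((hf.measurable k).comp (hf.measurable_projection hfree hA)) measurable_id)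

theorem isBorel_retractionSystem : (hf.retractionSystem hfree A).IsBorel where
  measurable_proj := hf.measurable_projection hfree hA
  measurable_index i := hf.measurable_classIndex (hfree.subrelation i) (hfree.factor i)
    (hf.measurableSet_sheet hfree hA i)
  measurable_retract i := (hf.measurable_select (hfree.subrelation i) (hfree.factor i)
    (hf.measurableSet_sheet hfree hA i)).comp
      (measurable_firstHit (hf.measurable_parent hfree hA) (hf.measurableSet_exitSet hfree hA i))
  measurable_lift := hf.measurable

end IsEnumeration

section Conj

variable {X : Type*}

theorem conj_restr_target_iff (φ : PartialEquiv X X) (s : X → X → Prop) {x y : X} :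
    conj φ (restr s φ.target) x y ↔ x ∈ φ.source ∧ y ∈ φ.source ∧ s (φ x) (φ y) :=
  ⟨fun ⟨hx, hy, _, _, h⟩ => ⟨hx, hy, h⟩,
    fun ⟨hx, hy, h⟩ => ⟨hx, hy, φ.map_source hx, φ.map_source hy, h⟩⟩

theorem IsCountableBorelEquivOn.conj_restr [MeasurableSpace X] {φ : PartialEquiv X X} {D : Set X}
    {s : X → X → Prop} (hs : IsCountableBorelEquivOn D s) (hφ : Measurable φ)
    (hsource : MeasurableSet φ.source) (hD : φ.target ⊆ D) :
    IsCountableBorelEquivOn φ.source (conj φ (restr s φ.target)) where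
  measurableSet_domain := hsource
  measurableSet_graph := by
    simp only [conj_restr_target_iff]
    exact (measurable_fst hsource).inter ((measurable_snd hsource).inter
      (hs.measurableSet_rel (hφ.comp measurable_fst) (hφ.comp measurable_snd)))
  mem_domain _ _ h := ⟨h.1, h.2.1⟩
  refl _ hx := (conj_restr_target_iff φ s).2 ⟨hx, hx, hs.refl (hD (φ.map_source hx))⟩
  symm _ _ h :=
    have ⟨hx, hy, hxy⟩ := (conj_restr_target_iff φ s).1 h
    (conj_restr_target_iff φ s).2 ⟨hy, hx, hs.symm hxy⟩
  trans _ _ _ h h' :=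
    have ⟨hx, _, hxy⟩ := (conj_restr_target_iff φ s).1 h
    have ⟨_, hz, hyz⟩ := (conj_restr_target_iff φ s).1 h'
    (conj_restr_target_iff φ s).2 ⟨hx, hz, hs.trans hxy hyz⟩
  countable_class x := by
    simp only [conj_restr_target_iff]
    exact MapsTo.countable_of_injOn (f := φ) (fun _ hy => hy.2.2)
      (φ.injOn.mono fun _ hy => hy.2.1) (hs.countable_class (φ x))

end Conj

section Reachability

variable {X : Type*}

/-- The pairs of points joined by a walk of length `n` in `H`, where `H` has its edges among the
pairs `(x, f m x)`. -/
def walkSet (f : ℕ → X → X) (H : SimpleGraph X) : ℕ → Set (X × X)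
  | 0 => {p | p.1 = p.2}
  | n + 1 => ⋃ m, {p | H.Adj p.1 (f m p.1) ∧ (f m p.1, p.2) ∈ walkSet f H n}

variable [MeasurableSpace X] {R : X → X → Prop} {f : ℕ → X → X} {H : SimpleGraph X}

namespace IsEnumeration

variable (hf : IsEnumeration R f) (hHR : ∀ x y, H.Adj x y → R x y)
include hf hHR

theorem reachable_iff {x y : X} : H.Reachable x y ↔ ∃ n, (x, y) ∈ walkSet f H n := by
  constructor
  · rintro ⟨p⟩
    induction p with
    | nil => exact ⟨0, rfl⟩
    | cons hadj _ ih =>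
      obtain ⟨n, hn⟩ := ih
      obtain ⟨m, rfl⟩ := hf.rel_iff.1 (hHR _ _ hadj)
      exact ⟨n + 1, mem_iUnion.2 ⟨m, hadj, hn⟩⟩
  · rintro ⟨n, hn⟩
    induction n generalizing x with
    | zero => exact (show x = y from hn) ▸ .refl x
    | succ n ih =>
      obtain ⟨m, hadj, hm⟩ := mem_iUnion.1 hn
      exact (SimpleGraph.Adj.reachable hadj).trans (ih hm)

theorem measurableSet_reachable [MeasurableEq X] (hH : MeasurableSet {p : X × X | H.Adj p.1 p.2}) :
    MeasurableSet {p : X × X | H.Reachable p.1 p.2} := by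
  have hwalk : ∀ n, MeasurableSet (walkSet f H n) := by
    intro n
    induction n with
    | zero => exact measurableSet_eq_fun measurable_fst measurable_snd
    | succ n ih =>
      refine .iUnion fun m => ?_
      have hm : Measurable fun p : X × X => f m p.1 := (hf.measurable m).comp measurable_fst
      exact ((measurable_fst.prodMk hm) hH).inter ((hm.prodMk measurable_snd) ih)
  simp only [hf.reachable_iff hHR, ofPred_exists]
  exact .iUnion hwalk

end IsEnumeration

end Reachability

namespace RetractionSystem

variable {X I : Type*} {R : X → X → Prop} {E : I → Set X}
  {r : I → X → X → Prop} {A : Set X} (P : RetractionSystem R E r A)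

theorem disjoint_saturation_piece {i : I} {k l : ℕ} (hkl : k ≠ l) :
    Disjoint (saturation (r i) (P.piece i k)) (saturation (r i) (P.piece i l)) := by
  refine disjoint_left.2 fun z ⟨x, hx, hxz⟩ ⟨y, hy, hyz⟩ => hkl ?_
  rw [← hx.2.2, ← hy.2.2, P.index_eq hxz, P.index_eq hyz]

theorem nonempty_source (i : I) (k : P.Index i) : (P.pieceEquiv i k.1).source.Nonempty :=
  have ⟨_, hx⟩ := k.2
  ⟨_, (P.pieceEquiv i k.1).map_target hx⟩

theorem target_subset (i : I) (k : ℕ) : (P.pieceEquiv i k).target ⊆ E i := fun _ hx => hx.1.1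

variable [MeasurableSpace X]

section FreeProduct

variable (hfree : IsFreeProduct univ R E r)
include hfree

theorem iUnion_saturation_piece (i : I) :
    ⋃ k : P.Index i, saturation (r i) (P.piece i k.1) = E i ∩ saturation R A := by
  ext x
  rw [mem_iUnion]
  refine ⟨fun ⟨k, z, hz, hzx⟩ => ?_, fun hx => ?_⟩
  · exact ⟨((hfree.factor i).mem_domain hzx).2,
      mem_saturation_of_rel hfree.equivalence hz.1.2 (hfree.subrelation _ _ _ hzx)⟩
  · have hmem := P.retract_mem_piece hfree hx
    exact ⟨⟨_, _, hmem⟩, _, hmem, (hfree.factor i).symm (P.rel_retract hx)⟩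

theorem mem_and_rel_of_mem_source {i : I} {k : ℕ} {a : X} (ha : a ∈ (P.pieceEquiv i k).source) :
    a ∈ A ∧ R a (P.pieceEquiv i k a) := by
  obtain ⟨hA, hrel⟩ := ha.2 ▸ P.proj_mem_and_rel_proj hfree ha.1.1.2
  exact ⟨hA, hfree.equivalence.symm hrel⟩

theorem source_subset (i : I) (k : ℕ) : (P.pieceEquiv i k).source ⊆ A :=
  fun _ ha => (P.mem_and_rel_of_mem_source hfree ha).1

theorem piece_zero (i : I) : P.piece i 0 = E i ∩ A := by
  ext x
  refine ⟨fun hx => ⟨hx.1.1, ?_⟩, fun hx => ⟨⟨hx.1, subset_saturation hfree.equivalence hx.2⟩,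
    P.retract_of_mem hx, P.index_of_mem hx⟩⟩
  have hproj : P.proj x = x := by simpa only [P.lift_zero, id] using lift_proj_of_mem_piece hx
  exact hproj ▸ (P.proj_mem_and_rel_proj hfree hx.1.2).1

theorem source_pieceEquiv_zero (i : I) : (P.pieceEquiv i 0).source = E i ∩ A := by
  ext a
  change P.lift 0 a ∈ P.piece i 0 ∧ P.proj (P.lift 0 a) = a ↔ _
  rw [P.lift_zero, P.piece_zero hfree]
  exact ⟨And.left, fun h => ⟨h, P.proj_of_mem h.2⟩⟩

theorem factor_zero (i : I) : P.factor i 0 = restr (r i) (E i ∩ A) := by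
  have hmap : ∀ a, P.pieceEquiv i 0 a = a := congrFun P.lift_zero
  funext a b
  rw [factor, conj_restr_target_iff, P.source_pieceEquiv_zero hfree, hmap, hmap, restr]

theorem exists_source_eq_and_factor_eq {i : I} (hne : (E i ∩ A).Nonempty) :
    ∃ k : P.Index i, (P.pieceEquiv i k.1).source = E i ∩ A ∧
      P.factor i k.1 = restr (r i) (E i ∩ A) :=
  ⟨⟨0, P.piece_zero hfree i ▸ hne⟩, P.source_pieceEquiv_zero hfree i, P.factor_zero hfree i⟩

end FreeProduct

variable {P} [MeasurableEq X] {f : ℕ → X → X} (hP : P.IsBorel) (hf : IsEnumeration R f)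
  (hfree : IsFreeProduct univ R E r) (hA : MeasurableSet A)

namespace IsBorel

include hP hf hfree hA

theorem measurableSet_piece (i : I) (k : ℕ) : MeasurableSet (P.piece i k) :=
  (hf.measurableSet_inter_saturation hfree hA i).inter
    ((measurableSet_eq_fun (hP.measurable_retract i) measurable_id).inter
      (hP.measurable_index i (measurableSet_singleton k)))

theorem measurableSet_source (i : I) (k : ℕ) : MeasurableSet (P.pieceEquiv i k).source :=
  (hP.measurable_lift k (hP.measurableSet_piece hf hfree hA i k)).inter
    (measurableSet_eq_fun (hP.measurable_proj.comp (hP.measurable_lift k)) measurable_id)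

theorem memFullPseudogroup_pieceEquiv (i : I) (k : ℕ) :
    MemFullPseudogroup R (P.pieceEquiv i k) where
  measurableSet_source := hP.measurableSet_source hf hfree hA i k
  measurableSet_target := hP.measurableSet_piece hf hfree hA i k
  measurable_toFun := (hP.measurable_lift k).comp measurable_subtype_coe
  measurable_invFun := hP.measurable_proj.comp measurable_subtype_coe
  graph_subset _ ha := (P.mem_and_rel_of_mem_source hfree ha).2

theorem measurableSet_saturation_target (i : I) (k : ℕ) :
    MeasurableSet (saturation (r i) (P.pieceEquiv i k).target) :=
  hf.measurableSet_saturation (hfree.subrelation i) (hfree.factor i)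
    (hP.measurableSet_piece hf hfree hA i k)

variable [Countable I]

theorem measurableSet_edge : MeasurableSet {p : X × X | P.edge p.1 p.2} := by
  have heq : {p : X × X | P.edge p.1 p.2} = ⋃ (i : I) (m : ℕ),
      {p | f m p.1 ∈ E i ∩ saturation R A ∧ P.proj (f m p.1) = p.1 ∧
        P.proj (P.retract i (f m p.1)) = p.2} := by
    ext ⟨a, b⟩
    simp only [mem_iUnion]
    refine ⟨?_, fun ⟨i, m, h⟩ => ⟨i, f m a, h⟩⟩
    rintro ⟨i, x, hx, rfl, hb⟩
    obtain ⟨m, hm⟩ :=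
      hf.rel_iff.1 (hfree.equivalence.symm (P.proj_mem_and_rel_proj hfree hx.2).2)
    exact ⟨i, m, by simpa only [mem_ofPred_eq, hm] using ⟨hx, trivial, hb⟩⟩
  rw [heq]
  refine .iUnion fun i => .iUnion fun m => ?_
  have hm : Measurable fun p : X × X => f m p.1 := (hf.measurable m).comp measurable_fst
  exact (hm (hf.measurableSet_inter_saturation hfree hA i)).inter
    ((measurableSet_eq_fun (hP.measurable_proj.comp hm) measurable_fst).inter
      (measurableSet_eq_fun (hP.measurable_proj.comp ((hP.measurable_retract i).comp hm))
        measurable_snd))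

theorem measurableSet_adj : MeasurableSet {p : X × X | P.graph.Adj p.1 p.2} := by
  have hedge := hP.measurableSet_edge hf hfree hA
  simp only [graph, SimpleGraph.fromRel_adj]
  exact (measurableSet_eq_fun measurable_fst measurable_snd).compl.inter
    (hedge.union (measurable_swap hedge))

theorem isCountableBorelEquivOn_tree : IsCountableBorelEquivOn A P.tree where
  measurableSet_domain := hA
  measurableSet_graph := (measurable_fst hA).inter ((measurable_snd hA).inter
    (hf.measurableSet_reachable (fun _ _ h => (P.restr_of_adj hfree h).2.2)
      (hP.measurableSet_adj hf hfree hA)))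
  mem_domain _ _ h := ⟨h.1, h.2.1⟩
  refl _ hx := ⟨hx, hx, .rfl⟩
  symm _ _ h := ⟨h.2.1, h.1, h.2.2.symm⟩
  trans _ _ _ h h' := ⟨h.1, h'.2.1, h.2.2.trans h'.2.2⟩
  countable_class x :=
    ((hf.isCountableBorelEquivOn hfree.equivalence).countable_class x).mono
      fun _ h => (P.restr_of_family (j := none) hfree h).2.2

theorem isTreeable_tree : IsTreeable A P.tree where
  isCountableBorelEquivOn := hP.isCountableBorelEquivOn_tree hf hfree hA
  exists_treeing := ⟨P.graph, hP.measurableSet_adj hf hfree hA, P.isAcyclic_graph hfree,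
    fun _ _ h => ⟨(P.restr_of_adj hfree h).1, (P.restr_of_adj hfree h).2.1⟩, fun _ _ => .rfl⟩

theorem isCountableBorelEquivOn_family (j : Option (Σ i, P.Index i)) :
    IsCountableBorelEquivOn (P.domain j) (P.family j) := by
  rcases j with _ | ⟨i, k, -⟩
  · exact hP.isCountableBorelEquivOn_tree hf hfree hA
  · exact (hfree.factor i).conj_restr (hP.measurable_lift k)
      (hP.measurableSet_source hf hfree hA i k) (P.target_subset i k)

end IsBorel

end RetractionSystem

end BER

theorem mainTheorem2_general {X : Type*} [MeasurableSpace X] [MeasurableEq X]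
    {I : Type*} [Countable I]
    (R : X → X → Prop) (f : ℕ → X → X) (hf : ∀ n, Measurable (f n))
    (hfR : ∀ x y, R x y ↔ ∃ n, f n x = y)
    (A' : I → Set X) (R' : I → X → X → Prop)
    (hfree : BER.IsFreeProduct Set.univ R A' R')
    (A : Set X) (hA : MeasurableSet A) :
    ∃ (K : I → Type) (φ : (i : I) → K i → PartialEquiv X X)
      (D : Set X) (T : X → X → Prop),
      (∀ i, Countable (K i)) ∧
      (∀ i k, BER.MemFullPseudogroup R (φ i k) ∧ (φ i k).source.Nonempty ∧
        (φ i k).source ⊆ A ∧ (φ i k).target ⊆ A' i) ∧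
      BER.IsTreeable D T ∧
      BER.IsFreeProduct A (BER.restr R A)
        (fun j : Option (Σ i, K i) => j.elim D (fun p => (φ p.1 p.2).source))
        (fun j : Option (Σ i, K i) => j.elim T (fun p =>
          BER.conj (φ p.1 p.2) (BER.restr (R' p.1) (φ p.1 p.2).target))) ∧
      (∀ i, (∀ k, MeasurableSet (BER.saturation (R' i) (φ i k).target)) ∧
        Pairwise (fun k l => Disjoint (BER.saturation (R' i) (φ i k).target)
          (BER.saturation (R' i) (φ i l).target)) ∧
        ⋃ k, BER.saturation (R' i) (φ i k).target = A' i ∩ BER.saturation R A) ∧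
      (∀ i, (A' i ∩ A).Nonempty → ∃ k, (φ i k).source = A' i ∩ A ∧
        BER.conj (φ i k) (BER.restr (R' i) (φ i k).target) =
          BER.restr (R' i) (A' i ∩ A)) := by
  have henum := BER.IsEnumeration.of_measurable hfree.equivalence hf hfR
  let P := henum.retractionSystem hfree A
  have hP : P.IsBorel := henum.isBorel_retractionSystem hfree hA
  exact ⟨P.Index, fun i k => P.pieceEquiv i k.1, A, P.tree, fun i => inferInstance,
    fun i k => ⟨hP.memFullPseudogroup_pieceEquiv henum hfree hA i k.1, P.nonempty_source i k,
      P.source_subset hfree i k.1, P.target_subset i k.1⟩,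
    hP.isTreeable_tree henum hfree hA,
    P.isFreeProduct hfree (hP.isCountableBorelEquivOn_family henum hfree hA),
    fun i => ⟨fun k => hP.measurableSet_saturation_target henum hfree hA i k.1,
      fun k l hkl => P.disjoint_saturation_piece fun h => hkl (Subtype.ext h),
      P.iUnion_saturation_piece hfree i⟩,
    fun i => P.exists_source_eq_and_factor_eq hfree⟩

theorem mainTheorem2 {X : Type*} [MeasurableSpace X] [StandardBorelSpace X]
    {I : Type*} [Countable I]
    (R : X → X → Prop) (hR : BER.IsCountableBorelEquivOn Set.univ R)
    (A' : I → Set X) (R' : I → X → X → Prop)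
    (hcover : ⋃ i, A' i = Set.univ)
    (hfree : BER.IsFreeProduct Set.univ R A' R')
    (A : Set X) (hA : MeasurableSet A) :
    ∃ (K : I → Type) (φ : (i : I) → K i → PartialEquiv X X)
      (D : Set X) (T : X → X → Prop),
      (∀ i, Countable (K i)) ∧
      (∀ i k, BER.MemFullPseudogroup R (φ i k) ∧ (φ i k).source.Nonempty ∧
        (φ i k).source ⊆ A ∧ (φ i k).target ⊆ A' i) ∧
      BER.IsTreeable D T ∧
      -- the restriction of `R` to `A` is the free product of `T` and of all the conjugates
      BER.IsFreeProduct A (BER.restr R A)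
        (fun j : Option (Σ i, K i) => j.elim D (fun p => (φ p.1 p.2).source))
        (fun j : Option (Σ i, K i) => j.elim T (fun p =>
          BER.conj (φ p.1 p.2) (BER.restr (R' p.1) (φ p.1 p.2).target))) ∧
      -- the saturations of the targets form a Borel partition
      (∀ i, (∀ k, MeasurableSet (BER.saturation (R' i) (φ i k).target)) ∧
        Pairwise (fun k l => Disjoint (BER.saturation (R' i) (φ i k).target)
          (BER.saturation (R' i) (φ i l).target)) ∧
        ⋃ k, BER.saturation (R' i) (φ i k).target = A' i ∩ BER.saturation R A) ∧
      -- one of the conjugates is the restriction of the factor to `A' i ∩ A`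
      (∀ i, (A' i ∩ A).Nonempty → ∃ k, (φ i k).source = A' i ∩ A ∧
        BER.conj (φ i k) (BER.restr (R' i) (φ i k).target) =
          BER.restr (R' i) (A' i ∩ A)) := by
  obtain ⟨f, hf, hfR⟩ := hR.exists_enumeration
  exact mainTheorem2_general R f hf hfR A' R' hfree A hA
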